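/- Let $\mathbb K\in\{\mathbb R,\mathbb C\}$ and let $M$ be a smooth or real analytic manifold ($\mathbb K=\mathbb R$) or a complex manifold ($\mathbb K=\mathbb C$), finite-dimensional, Hausdorff and second countable; all objects below belong to the corresponding category, $\mathcal O_M$ is the sheaf of functions, and sections are sections of sheaves over open subsets. A singular foliation $\mathcal F$ on $M$ is a subsheaf of $\mathcal O_M$-modules of the sheaf $\mathfrak X_M$ of vector fields which is stable under the Lie bracket and locally finitely generated. Its leaves are the orbits of the flows of its local sections; every leaf $L$ is an immersed submanifold with $T_mL=\{X(m): X\in\mathcal F\}$ for $m\in L$. Let $M_{\mathrm{reg}}$ be the set of points of $M$ near which the dimension of the leaves is constant. Let $\rho\colon A\to TM$ be an anchored bundle over $\mathcal F$, i.e. a morphism from a finite rank vector bundle $A$ to $TM$ with $\rho(\Gamma(A))=\mathcal F$ (as sheaves). The Helffer–Nourrigat cone is $$\mathrm{NH}(\mathcal F)=\overline{\bigcup_{m\in M_{\mathrm{reg}}}\rho_m^*(T_m^*M)}\subset A^*.$$ For a Lie algebroid $(E,[\cdot,\cdot]_E,\rho_E)$ over a manifold $N$, the linear Poisson structure on $\mathrm{pr}\colon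 E^*\to N$ is the one with $\{\mathrm{ev}_a,\mathrm{ev}_b\}=\mathrm{ev}_{[a,b]_E}$, $\{\mathrm{ev}_a,\mathrm{pr}^*f\}=\mathrm{pr}^*(\rho_E(a)[f])$ and $\{\mathrm{pr}^*f,\mathrm{pr}^*g\}=0$ for local sections $a,b$ of $E$ and local functions $f,g$ on $N$, where $\mathrm{ev}_a(\alpha)=\langle\alpha,a(\mathrm{pr}(\alpha))\rangle$. Its symplectic leaves are the orbits of the flows of local Hamiltonian vector fields. 1. If $[\cdot,\cdot]_A$ is a Lie algebroid structure on $A$ with anchor $\rho$, then $\mathrm{NH}(\mathcal F)$ is a union of symplectic leaves of the associated linear Poisson structure on $A^*$. 2. Let $L$ be a leaf of $\mathcal F$. Let $\mathrm{Sker}\,\rho_m\subset A_m$ be the set of values at $m$ of the local sections $a$ of $A$ near $m$ with $\rho(a)=0$, and let $A_L=A|_L/\mathrm{Sker}\,\rho|_L$ be the holonomy Lie algebroid of $L$: its anchor $A_L\to TL$ is induced by $\rho$, and the bracket of the sections of $A_L$ induced by local sections $a,b$ of $A$ is induced by any local section $c$ of $A$ with $\rho(c)=[\rho(a),\rho(b)]$.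 Identify $A_L^*$ with the annihilator of $\mathrm{Sker}\,\rho|_L$ in $A^*|_L$. Then the restriction $\mathrm{NH}(\mathcal F)|_L$ is contained in $A_L^*$, and it is a union of symplectic leaves of the linear Poisson structure on $A_L^*$. -/

import Mathlib

open Bundle TopologicalSpace
open scoped Manifold ContDiff Topology

noncomputable section

/-! ### Vector fields, singular foliations and leaves

A vector field (section, function) on an open set `U` is represented by a globally defined,
not necessarily continuous one, of which only the restriction to `U` matters. -/

section Foliations

variable {𝕜 : Type*} [RCLike 𝕜]
  {E : Type*} [NormedAddCommGroup E] [NormedSpace 𝕜 E]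
  {H : Type*} [TopologicalSpace H] (I : ModelWithCorners 𝕜 E H) (n : WithTop ℕ∞)
  {M : Type*} [TopologicalSpace M] [ChartedSpace H M]

/-- The derivative `v[f]` of the function `f` along the tangent vector `v` at `x`. -/
def dirDeriv (f : M → 𝕜) (x : M) (v : TangentSpace I x) : 𝕜 :=
  mfderiv I 𝓘(𝕜, 𝕜) f x v

/-- Two points are joined by an integral curve of a vector field belonging to the family `D` of
locally defined vector fields. The time parameter lives in an open connected subset of `𝕜`, i.e.
it is real for real manifolds and complex for complex manifolds. -/
def FlowStep (D : Opens M → Set (Π x : M, TangentSpace I x)) (x y : M) : Prop :=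
  ∃ (U : Opens M) (X : Π x : M, TangentSpace I x) (s : Set 𝕜) (γ : 𝕜 → M),
    X ∈ D U ∧ IsOpen s ∧ IsPreconnected s ∧
    (∀ t ∈ s, γ t ∈ U ∧
      HasMFDerivAt 𝓘(𝕜, 𝕜) I γ t ((1 : 𝕜 →L[𝕜] 𝕜).smulRight (X (γ t)))) ∧
    ∃ t₀ ∈ s, ∃ t₁ ∈ s, γ t₀ = x ∧ γ t₁ = y

/-- The orbit of `x` under the flows of the vector fields in the family `D`. -/
def flowOrbit (D : Opens M → Set (Π x : M, TangentSpace I x)) (x : M) : Set M :=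
  {y | Relation.ReflTransGen (FlowStep I D) x y}

variable (M) in
/-- A singular foliation on `M` (in the class `C^n` over `𝕜`): a subsheaf of modules over functions
of the sheaf of vector fields which is stable under the Lie bracket and locally finitely
generated: near every point, finitely many of its sections generate it as a sheaf of modules. -/
structure SingularFoliation [IsManifold I 1 M] where
  /-- The vector fields on `U` that belong to the foliation. -/
  sections : Opens M → Set (Π x : M, TangentSpace I x)
  contMDiffOn : ∀ U : Opens M, ∀ X ∈ sections U,
    ContMDiffOn I I.tangent n (fun x ↦ (⟨x, X x⟩ : TangentBundle I M)) U
  congr : ∀ U : Opens M, ∀ X ∈ sections U, ∀ Y : Π x : M, TangentSpace I x,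
    (∀ x ∈ U, X x = Y x) → Y ∈ sections U
  restrict : ∀ U V : Opens M, V ≤ U → ∀ X ∈ sections U, X ∈ sections V
  glue : ∀ U : Opens M, ∀ X : Π x : M, TangentSpace I x,
    (∀ x ∈ U, ∃ V, x ∈ V ∧ V ≤ U ∧ X ∈ sections V) → X ∈ sections U
  zero_mem : ∀ U : Opens M, (fun _ ↦ 0) ∈ sections U
  add_mem : ∀ U : Opens M, ∀ X ∈ sections U, ∀ Y ∈ sections U, (fun x ↦ X x + Y x) ∈ sections U
  smul_mem : ∀ U : Opens M, ∀ f : M → 𝕜, ContMDiffOn I 𝓘(𝕜, 𝕜) n f U →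
    ∀ X ∈ sections U, (fun x ↦ f x • X x) ∈ sections U
  lie_mem : ∀ U : Opens M, ∀ X ∈ sections U, ∀ Y ∈ sections U,
    VectorField.mlieBracket I X Y ∈ sections U
  locally_finitely_generated : ∀ m : M, ∃ U : Opens M, m ∈ U ∧
    ∃ (k : ℕ) (X : Fin k → Π x : M, TangentSpace I x), (∀ i, X i ∈ sections U) ∧
      ∀ V, V ≤ U → ∀ Y ∈ sections V, ∀ m' ∈ V, ∃ W : Opens M, m' ∈ W ∧ W ≤ V ∧
        ∃ f : Fin k → M → 𝕜, (∀ i, ContMDiffOn I 𝓘(𝕜, 𝕜) n (f i) W) ∧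
          ∀ x ∈ W, Y x = ∑ i, f i x • X i x

namespace SingularFoliation

variable {I n} [IsManifold I 1 M] (F : SingularFoliation I n M)

/-- The image of the evaluation map `F → T_m M`, i.e. the tangent space of the leaf through `m`. -/
def tangent (m : M) : Submodule 𝕜 (TangentSpace I m) :=
  Submodule.span 𝕜 {v | ∃ U : Opens M, m ∈ U ∧ ∃ X ∈ F.sections U, X m = v}

/-- `M_reg`: the points near which the dimension of the leaves is constant. -/
def regular : Set M :=
  {m | ∀ᶠ y in 𝓝 m, Module.finrank 𝕜 (F.tangent y) = Module.finrank 𝕜 (F.tangent m)}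

/-- The leaf through `m`, as a subset of `M`. -/
def leaf (m : M) : Set M := flowOrbit I F.sections m

variable {EL : Type*} [NormedAddCommGroup EL] [NormedSpace 𝕜 EL]
  {HL : Type*} [TopologicalSpace HL] (IL : ModelWithCorners 𝕜 EL HL)
  {L : Type*} [TopologicalSpace L] [ChartedSpace HL L]

/-- The manifold `L`, injectively immersed in `M` through `ι`, is a leaf of the foliation. -/
structure IsLeaf (ι : L → M) : Prop where
  contMDiff : ContMDiff IL I n ι
  injective : Function.Injective ι
  immersion : ∀ l, Function.Injective (mfderiv IL I ι l)
  tangent_eq : ∀ l, Set.range (mfderiv IL I ι l) = (F.tangent (ι l) : Set (TangentSpace I (ι l)))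
  range_eq : ∃ m, Set.range ι = F.leaf m

end SingularFoliation

end Foliations

/-! ### Poisson manifolds and symplectic leaves -/

section Poisson

variable {𝕜 : Type*} [RCLike 𝕜]
  {E : Type*} [NormedAddCommGroup E] [NormedSpace 𝕜 E]
  {H : Type*} [TopologicalSpace H] (I : ModelWithCorners 𝕜 E H) (n : WithTop ℕ∞)
  (P : Type*) [TopologicalSpace P] [ChartedSpace H P]

/-- The bracket `{f, g}(p) = Λ_p(d_p f, d_p g)` defined by a field `Λ` of bilinear forms on
cotangent spaces. -/
def bivectorBracket {P : Type*} [TopologicalSpace P] [ChartedSpace H P]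
    (Λ : Π p : P, (TangentSpace I p →L[𝕜] 𝕜) →ₗ[𝕜] (TangentSpace I p →L[𝕜] 𝕜) →ₗ[𝕜] 𝕜)
    (f g : P → 𝕜) (p : P) : 𝕜 :=
  Λ p (mfderiv I 𝓘(𝕜, 𝕜) f p) (mfderiv I 𝓘(𝕜, 𝕜) g p)

/-- A Poisson structure: a bivector field of class `C^n` whose bracket satisfies the Jacobi
identity. -/
structure PoissonStructure where
  /-- The bivector field. -/
  bivector : Π p : P, (TangentSpace I p →L[𝕜] 𝕜) →ₗ[𝕜] (TangentSpace I p →L[𝕜] 𝕜) →ₗ[𝕜] 𝕜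
  alternating : ∀ p θ, bivector p θ θ = 0
  contMDiffOn : ∀ (U : Opens P) (f g : P → 𝕜), ContMDiffOn I 𝓘(𝕜, 𝕜) n f U →
    ContMDiffOn I 𝓘(𝕜, 𝕜) n g U → ContMDiffOn I 𝓘(𝕜, 𝕜) n (bivectorBracket I bivector f g) U
  jacobi : ∀ (U : Opens P) (f g h : P → 𝕜), ContMDiffOn I 𝓘(𝕜, 𝕜) n f U →
    ContMDiffOn I 𝓘(𝕜, 𝕜) n g U → ContMDiffOn I 𝓘(𝕜, 𝕜) n h U → ∀ p ∈ U,
      bivectorBracket I bivector f (bivectorBracket I bivector g h) p +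
      bivectorBracket I bivector g (bivectorBracket I bivector h f) p +
      bivectorBracket I bivector h (bivectorBracket I bivector f g) p = 0

namespace PoissonStructure

variable {I n P} (Λ : PoissonStructure I n P)

/-- The Poisson bracket of functions. -/
def bracket (f g : P → 𝕜) : P → 𝕜 := bivectorBracket I Λ.bivector f g

/-- The Hamiltonian vector fields `X_h = {·, h}` on `U` of the functions `h` defined on `U`. -/
def hamiltonianFields (U : Opens P) : Set (Π p : P, TangentSpace I p) :=
  {X | ∃ h : P → 𝕜, ContMDiffOn I 𝓘(𝕜, 𝕜) n h U ∧
    ∀ p ∈ U, ∀ θ : TangentSpace I p →L[𝕜] 𝕜,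
      θ (X p) = Λ.bivector p θ (mfderiv I 𝓘(𝕜, 𝕜) h p)}

/-- The symplectic leaf through `p`: the points that can be reached from `p` by following
successively the flows of finitely many (local) Hamiltonian vector fields. -/
def symplecticLeaf (p : P) : Set P := flowOrbit I Λ.hamiltonianFields p

/-- The set `S` is a union of symplectic leaves. -/
def IsUnionOfSymplecticLeaves (S : Set P) : Prop :=
  ∃ T : Set P, S = ⋃ p ∈ T, Λ.symplecticLeaf p

end PoissonStructure

end Poisson

/-! ### Anchored bundles, Lie algebroids and the Helffer–Nourrigat cone -/

section Algebroids

variable {𝕜 : Type*} [RCLike 𝕜]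
  {E : Type*} [NormedAddCommGroup E] [NormedSpace 𝕜 E]
  {H : Type*} [TopologicalSpace H] (I : ModelWithCorners 𝕜 E H) (n : WithTop ℕ∞)
  {M : Type*} [TopologicalSpace M] [ChartedSpace H M]
  (FA : Type*) [NormedAddCommGroup FA] [NormedSpace 𝕜 FA]
  {A : M → Type*} [TopologicalSpace (TotalSpace FA A)]
  [∀ x, AddCommGroup (A x)] [∀ x, Module 𝕜 (A x)] [∀ x, TopologicalSpace (A x)]
  [FiberBundle FA A] [VectorBundle 𝕜 FA A]

/-- `a` is a section of class `C^n` of the bundle `A` on the open set `U`. -/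
def IsSectionOn (U : Opens M) (a : Π x : M, A x) : Prop :=
  ContMDiffOn I (I.prod 𝓘(𝕜, FA)) n (fun x ↦ (⟨x, a x⟩ : TotalSpace FA A)) U

/-- The fibres of the dual bundle `A^*`. -/
abbrev DualFiber (𝕜 : Type*) [RCLike 𝕜] {M : Type*} (A : M → Type*)
    [∀ x, AddCommGroup (A x)] [∀ x, Module 𝕜 (A x)] [∀ x, TopologicalSpace (A x)] (x : M) :=
  A x →L[𝕜] Bundle.Trivial M 𝕜 x

/-- The total space of the dual bundle `A^*`. -/
abbrev DualBundle (𝕜 : Type*) [RCLike 𝕜] {M : Type*}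
    (FA : Type*) [NormedAddCommGroup FA] [NormedSpace 𝕜 FA] (A : M → Type*)
    [∀ x, AddCommGroup (A x)] [∀ x, Module 𝕜 (A x)] [∀ x, TopologicalSpace (A x)] :=
  TotalSpace (FA →L[𝕜] 𝕜) (DualFiber 𝕜 A)

/-- The fibrewise linear function `ev_a` on `A^*` defined by a section `a` of `A`. -/
def evSection (a : Π x : M, A x) (α : DualBundle 𝕜 FA A) : 𝕜 := α.2 (a α.1)

/-- The bundle morphism `ρ : A → TM` (covering the identity) is of class `C^n`. -/
def IsBundleMorphism [IsManifold I 1 M] (ρ : Π x : M, A x →L[𝕜] TangentSpace I x) : Prop :=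
  ContMDiff (I.prod 𝓘(𝕜, FA)) I.tangent n
    (fun p : TotalSpace FA A ↦ (⟨p.1, ρ p.1 p.2⟩ : TangentBundle I M))

/-- A Lie algebroid structure with anchor `ρ`: a Lie bracket on the sheaf of sections of `A`
which satisfies the Leibniz rule. The bracket of sections defined on an open set `U` only matters
on `U`. (Compatibility of the anchor with brackets is automatic, and customarily listed.) -/
structure LieAlgebroid [IsManifold I 1 M] (ρ : Π x : M, A x →L[𝕜] TangentSpace I x) where
  isBundleMorphism : IsBundleMorphism I n FA ρ
  /-- The bracket of sections. -/
  bracket : (Π x : M, A x) → (Π x : M, A x) → Π x : M, A x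
  isSectionOn : ∀ U a b, IsSectionOn I n FA U a → IsSectionOn I n FA U b →
    IsSectionOn I n FA U (bracket a b)
  congr : ∀ U a b b', IsSectionOn I n FA U a → IsSectionOn I n FA U b →
    IsSectionOn I n FA U b' → (∀ x ∈ U, b x = b' x) → ∀ x ∈ U, bracket a b x = bracket a b' x
  skew : ∀ U a b, IsSectionOn I n FA U a → IsSectionOn I n FA U b →
    ∀ x ∈ U, bracket a b x = - bracket b a x
  add_right : ∀ U a b c, IsSectionOn I n FA U a → IsSectionOn I n FA U b →
    IsSectionOn I n FA U c → ∀ x ∈ U,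
      bracket a (fun y ↦ b y + c y) x = bracket a b x + bracket a c x
  leibniz : ∀ U a b (f : M → 𝕜), IsSectionOn I n FA U a → IsSectionOn I n FA U b →
    ContMDiffOn I 𝓘(𝕜, 𝕜) n f U → ∀ x ∈ U,
      bracket a (fun y ↦ f y • b y) x =
        f x • bracket a b x + dirDeriv I f x (ρ x (a x)) • b x
  jacobi : ∀ U a b c, IsSectionOn I n FA U a → IsSectionOn I n FA U b →
    IsSectionOn I n FA U c → ∀ x ∈ U,
      bracket a (bracket b c) x + bracket b (bracket c a) x + bracket c (bracket a b) x = 0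
  anchor_bracket : ∀ U a b, IsSectionOn I n FA U a → IsSectionOn I n FA U b → ∀ x ∈ U,
    ρ x (bracket a b x) =
      VectorField.mlieBracket I (fun y ↦ ρ y (a y)) (fun y ↦ ρ y (b y)) x

variable {I n} in
/-- `ρ : A → TM` is an anchored bundle over `F`: it is a vector bundle morphism and
`ρ(Γ(A)) = F` as sheaves. -/
structure IsAnchoredBundle [IsManifold I 1 M] (F : SingularFoliation I n M)
    (ρ : Π x : M, A x →L[𝕜] TangentSpace I x) : Prop where
  isBundleMorphism : IsBundleMorphism I n FA ρ
  image_eq : ∀ (U : Opens M) (X : Π x : M, TangentSpace I x),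
    X ∈ F.sections U ↔ ∀ x ∈ U, ∃ V : Opens M, x ∈ V ∧ V ≤ U ∧
      ∃ a : Π x : M, A x, IsSectionOn I n FA V a ∧ ∀ y ∈ V, ρ y (a y) = X y

/-- The strong kernel of `ρ` at `m`: the values at `m` of the local sections of `A` that are
annihilated by `ρ`. -/
def strongKernel (ρ : Π x : M, A x →L[𝕜] TangentSpace I x) (m : M) : Set (A m) :=
  {u | ∃ U : Opens M, m ∈ U ∧
    ∃ a : Π x : M, A x, IsSectionOn I n FA U a ∧ (∀ x ∈ U, ρ x (a x) = 0) ∧ a m = u}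

variable [∀ x, IsTopologicalAddGroup (A x)] [∀ x, ContinuousSMul 𝕜 (A x)]

variable {I n} in
/-- The Helffer–Nourrigat cone: the closure in `A^*` of the union over the regular points `m` of
the images of `ρ_m^* : T_m^* M → A_m^*`. -/
def helfferNourrigatCone [IsManifold I 1 M] (F : SingularFoliation I n M)
    (ρ : Π x : M, A x →L[𝕜] TangentSpace I x) : Set (DualBundle 𝕜 FA A) :=
  closure {α | α.1 ∈ F.regular ∧
    ∃ ξ : TangentSpace I α.1 →L[𝕜] 𝕜, ∀ u : A α.1, α.2 u = ξ (ρ α.1 u)}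

variable {I n FA} in
/-- `Λ` is the linear Poisson structure on `A^*` associated with the Lie algebroid `A`. -/
structure LieAlgebroid.IsLinearPoisson [IsManifold I 1 M]
    {ρ : Π x : M, A x →L[𝕜] TangentSpace I x}
    (g : LieAlgebroid I n FA ρ)
    (Λ : PoissonStructure (I.prod 𝓘(𝕜, FA →L[𝕜] 𝕜)) n (DualBundle 𝕜 FA A)) : Prop where
  ev_ev : ∀ U a b, IsSectionOn I n FA U a → IsSectionOn I n FA U b →
    ∀ α : DualBundle 𝕜 FA A, α.1 ∈ U →
      Λ.bracket (evSection FA a) (evSection FA b) α = evSection FA (g.bracket a b) α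
  ev_fun : ∀ U a (f : M → 𝕜), IsSectionOn I n FA U a → ContMDiffOn I 𝓘(𝕜, 𝕜) n f U →
    ∀ α : DualBundle 𝕜 FA A, α.1 ∈ U →
      Λ.bracket (evSection FA a) (fun β ↦ f β.1) α = dirDeriv I f α.1 (ρ α.1 (a α.1))
  fun_fun : ∀ (U : Opens M) (f g : M → 𝕜), ContMDiffOn I 𝓘(𝕜, 𝕜) n f U →
    ContMDiffOn I 𝓘(𝕜, 𝕜) n g U → ∀ α : DualBundle 𝕜 FA A, α.1 ∈ U →
      Λ.bracket (fun β ↦ f β.1) (fun β ↦ g β.1) α = 0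

end Algebroids

/-! ### The holonomy Lie algebroid of a leaf -/

section Holonomy

variable {𝕜 : Type*} [RCLike 𝕜]
  {E : Type*} [NormedAddCommGroup E] [NormedSpace 𝕜 E]
  {H : Type*} [TopologicalSpace H] {I : ModelWithCorners 𝕜 E H} {n : WithTop ℕ∞}
  {M : Type*} [TopologicalSpace M] [ChartedSpace H M]
  {FA : Type*} [NormedAddCommGroup FA] [NormedSpace 𝕜 FA]
  {A : M → Type*} [TopologicalSpace (TotalSpace FA A)]
  [∀ x, AddCommGroup (A x)] [∀ x, Module 𝕜 (A x)] [∀ x, TopologicalSpace (A x)]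
  [FiberBundle FA A] [VectorBundle 𝕜 FA A]
  {EL : Type*} [NormedAddCommGroup EL] [NormedSpace 𝕜 EL]
  {HL : Type*} [TopologicalSpace HL] {IL : ModelWithCorners 𝕜 EL HL}
  {L : Type*} [TopologicalSpace L] [ChartedSpace HL L]
  {FB : Type*} [NormedAddCommGroup FB] [NormedSpace 𝕜 FB]
  {B : L → Type*} [TopologicalSpace (TotalSpace FB B)]
  [∀ x, AddCommGroup (B x)] [∀ x, Module 𝕜 (B x)] [∀ x, TopologicalSpace (B x)]
  [FiberBundle FB B] [VectorBundle 𝕜 FB B]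

variable (FA) in
/-- The bundle `B → L` with anchor `σ` and bracket `h` is the holonomy Lie algebroid
`A_L = A|_L / Sker ρ|_L` of the leaf `ι : L → M`, with quotient map `q : A|_L → B`. The anchor and
the bracket of `A_L` are those induced from the vector fields `ρ(a)` and their Lie brackets. -/
structure IsHolonomyLieAlgebroid [IsManifold IL 1 L]
    (ρ : Π x : M, A x →L[𝕜] TangentSpace I x) (ι : L → M)
    (q : Π l : L, A (ι l) →L[𝕜] B l) {σ : Π l : L, B l →L[𝕜] TangentSpace IL l}
    (h : LieAlgebroid IL n FB σ) : Prop where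
  /-- The quotient map `A|_L → B` is of class `C^n`: it maps restrictions to `L` of sections
  of `A` to sections of `B`. -/
  isSectionOn : ∀ (U : Opens M) (V : Opens L) (a : Π x : M, A x), (∀ l ∈ V, ι l ∈ U) →
    IsSectionOn I n FA U a → IsSectionOn IL n FB V (fun l ↦ q l (a (ι l)))
  surjective : ∀ l, Function.Surjective (q l)
  kernel : ∀ l (u : A (ι l)), q l u = 0 ↔ u ∈ strongKernel I n FA ρ (ι l)
  anchor : ∀ l (u : A (ι l)), mfderiv IL I ι l (σ l (q l u)) = ρ (ι l) u
  bracket : ∀ (U : Opens M) (a b c : Π x : M, A x), IsSectionOn I n FA U a →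
    IsSectionOn I n FA U b → IsSectionOn I n FA U c →
    (∀ x ∈ U, ρ x (c x) =
      VectorField.mlieBracket I (fun y ↦ ρ y (a y)) (fun y ↦ ρ y (b y)) x) →
    ∀ l, ι l ∈ U →
      h.bracket (fun k ↦ q k (a (ι k))) (fun k ↦ q k (b (ι k))) l = q l (c (ι l))

/-- The restriction to `L` of a subset `S` of `A^*`, as a subset of `A_L^*`, which is
identified through the transpose of the quotient map `q` with the annihilator of the strong kernel
in `A^*|_L`. -/
def restrictToLeaf (S : Set (DualBundle 𝕜 FA A)) (ι : L → M) (q : Π l : L, A (ι l) →L[𝕜] B l) :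
    Set (DualBundle 𝕜 FB B) :=
  {β | (⟨ι β.1, β.2.comp (q β.1)⟩ : DualBundle 𝕜 FA A) ∈ S}

end Holonomy

end

/-!
The two parts are instances of one statement: if a Lie algebroid `B` over a manifold `L`, immersed
in `M` by `ι`, is a quotient of the pullback of `A`, with brackets induced by `[ρ(a), ρ(b)]`
(`IsQuotientAlgebroid`), then the restriction of the Helffer–Nourrigat cone to `B^*` is a union of
symplectic leaves. The first part is the case of the identity, the second one that of a leaf and
its holonomy Lie algebroid.

The statement is local, so that coordinates can be used. There `A` is trivial with fibre `G`, the anchor is a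
function `R : E → Hom(G, E)`, and the choice of local sections `c` with `ρ(c) = [ρ(a), ρ(b)]`, for
`a` and `b` in the frame, gives structure functions `C : E → Hom(G ⊗ G, G)`. These need not
satisfy the Jacobi identity, but they are compatible with the anchor, and this suffices. The
transpose of the quotient map immerses `B^*` in `A^*`, and so an integral curve of the Hamiltonian
vector field of a function on `B^*` becomes a curve in `E × G^*` with derivative
`hamField R C · p`, where the control `p` is a continuous function of time, namely an extension to `E × G^*` of
the differential of the function along the curve (`IsQuotientAlgebroid.bivector_eq`,
`IsQuotientAlgebroid.exists_factor_mfderiv`).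

Along a solution `(y, α)` of such an equation the kernel of the anchor is transported by the
linear equation `V' = -C(V, p)`: if `k` is in the kernel of `R (y 0)`, then `V k` is in the kernel
of `R (y t)` and `α (V k)` is constant (`IsControlled.exists_transport`). Hence the rank of the
anchor is constant along solutions, the regular points are preserved, and so is the property that
`α` vanishes on the kernel of `R y`, i.e. that `α` is in the image of the transpose of `R y`
(`IsControlled.mem_regularCone`). As solutions depend continuously on the starting point, the
closure of the set of these `(y, α)`, which is the cone in the chart, is invariant as well
(`IsControlled.mem_closure_regularCone`). Working with the solutions in `A^*` for a fixed control,
and not with those in `B^*`, is essential here: the points of the cone are limits of points of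
`A^*` over regular points, and these are in general not in `B^*`.

That the restriction of the cone to a leaf is contained in the annihilator of the strong kernel
follows from the continuity of the functions `ev_a` with `ρ(a) = 0`, which vanish on the cone over
the regular points.
-/

noncomputable section

/-! ### Hamiltonian curves in local coordinates -/

section Core

open Set Metric

variable {𝕜 : Type*} [RCLike 𝕜]
  {E : Type*} [NormedAddCommGroup E] [NormedSpace 𝕜 E]
  {G : Type*} [NormedAddCommGroup G] [NormedSpace 𝕜 G]
  {R : E → G →L[𝕜] E} {C : E → G →L[𝕜] G →L[𝕜] G}

/-- The value at `x = (y, α)` of a Hamiltonian vector field on `E × G^*`, the dual of the trivial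
bundle with fibre `G` over the vector space `E`, for the anchor `R` and the structure functions
`C` (the bracket of the constant sections `v`, `w` is `y ↦ C y v w`). If the differential of the
Hamiltonian at `x` is `(π, v)`, with `π` a covector on `E` and `v` an element of `G ≅ G^**`, then
`p = (v, π)`. -/
def hamField (R : E → G →L[𝕜] E) (C : E → G →L[𝕜] G →L[𝕜] G)
    (x : E × (G →L[𝕜] 𝕜)) (p : G × (E →L[𝕜] 𝕜)) : E × (G →L[𝕜] 𝕜) :=
  (-(R x.1 p.1), x.2 ∘L (C x.1).flip p.1 + p.2 ∘L R x.1)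

theorem hamField_neg (x : E × (G →L[𝕜] 𝕜)) (p : G × (E →L[𝕜] 𝕜)) :
    hamField R C x (-p) = - hamField R C x p := by
  simp [hamField]
  abel

theorem hamField_smul (c : 𝕜) (x : E × (G →L[𝕜] 𝕜)) (p : G × (E →L[𝕜] 𝕜)) :
    hamField R C x (c • p) = c • hamField R C x p := by
  simp [hamField]

variable (R C) in
/-- Estimates on the closed ball of radius `a` around `x₀` which ensure that the curves with
derivative `hamField R C · p` exist for times in `[0, 1]` if they start in the ball of half the
radius, for all continuous controls `p` with values of norm at most `ε`. The field `structure_eq`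
says that the anchor is compatible with brackets of constant sections. -/
structure IsFlowBox (x₀ : E × (G →L[𝕜] 𝕜)) (a ε : ℝ) (K : NNReal) : Prop where
  a_pos : 0 < a
  ε_pos : 0 < ε
  mul_le : K * ε ≤ 1 / 4
  mul_le' : K * ε ≤ a / 4
  ε_le : ε ≤ 1
  differentiableAt : ∀ x ∈ closedBall x₀ a, DifferentiableAt 𝕜 R x.1
  continuousOn : ContinuousOn (fun x : E × (G →L[𝕜] 𝕜) ↦ C x.1) (closedBall x₀ a)
  fderiv_le : ∀ x ∈ closedBall x₀ a, ‖fderiv 𝕜 R x.1‖ ≤ K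
  norm_le : ∀ x ∈ closedBall x₀ a, ‖C x.1‖ ≤ K
  structure_eq : ∀ x ∈ closedBall x₀ a, ∀ v w, R x.1 (C x.1 v w) =
    fderiv 𝕜 R x.1 (R x.1 v) w - fderiv 𝕜 R x.1 (R x.1 w) v
  lipschitz : ∀ p, ‖p‖ ≤ ε → LipschitzOnWith K (fun x ↦ hamField R C x p) (closedBall x₀ a)
  field_le : ∀ p, ‖p‖ ≤ ε → ∀ x ∈ closedBall x₀ a, ‖hamField R C x p‖ ≤ K * ε

theorem exists_isFlowBox (x₀ : E × (G →L[𝕜] 𝕜)) (hR : ContDiffAt 𝕜 1 R x₀.1)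
    (hC : ContDiffAt 𝕜 1 C x₀.1)
    (hRC : ∀ᶠ y in 𝓝 x₀.1, ∀ v w, R y (C y v w) =
      fderiv 𝕜 R y (R y v) w - fderiv 𝕜 R y (R y w) v) :
    ∃ a ε K, IsFlowBox R C x₀ a ε K := by
  have hfst : Filter.Tendsto (fun x : E × (G →L[𝕜] 𝕜) ↦ x.1) (𝓝 x₀) (𝓝 x₀.1) :=
    continuous_fst.continuousAt
  have hT : ContDiffAt 𝕜 1 (fun z : (E × (G →L[𝕜] 𝕜)) × (G × (E →L[𝕜] 𝕜)) ↦
      hamField R C z.1 z.2) (x₀, 0) := by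
    have hR' : ContDiffAt 𝕜 1 (fun z : (E × (G →L[𝕜] 𝕜)) × (G × (E →L[𝕜] 𝕜)) ↦ R z.1.1)
      (x₀, 0) := ContDiffAt.comp (g := R) (x₀, 0) hR (by fun_prop)
    have hC' : ContDiffAt 𝕜 1 (fun z : (E × (G →L[𝕜] 𝕜)) × (G × (E →L[𝕜] 𝕜)) ↦ C z.1.1)
      (x₀, 0) := ContDiffAt.comp (g := C) (x₀, 0) hC (by fun_prop)
    have hC'' : ContDiffAt 𝕜 1 (fun z : (E × (G →L[𝕜] 𝕜)) × (G × (E →L[𝕜] 𝕜)) ↦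
        (C z.1.1).flip) (x₀, 0) :=
      (ContinuousLinearMap.flipₗᵢ 𝕜 G G G).contDiff.contDiffAt.comp (x₀, 0) hC'
    unfold hamField
    fun_prop
  obtain ⟨K₁, t, ht, hK₁⟩ := hT.exists_lipschitzOnWith
  obtain ⟨t₁, ht₁, t₂, ht₂, htt⟩ := mem_nhds_prod_iff.1 ht
  obtain ⟨ε₀, hε₀, hball⟩ := Metric.mem_nhds_iff.1 ht₂
  have e1 : ∀ᶠ y in 𝓝 x₀.1, DifferentiableAt 𝕜 R y :=
    (hR.eventually (by simp)).mono fun y hy ↦ hy.differentiableAt (by simp)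
  have e2 : ∀ᶠ y in 𝓝 x₀.1, ContinuousAt C y :=
    (hC.eventually (by simp)).mono fun y hy ↦ hy.continuousAt
  have e3 : ∀ᶠ y in 𝓝 x₀.1, ‖fderiv 𝕜 R y‖ ≤ ‖fderiv 𝕜 R x₀.1‖ + 1 := by
    have := (hR.fderiv_right (m := 0) (by simp)).continuousAt.norm
    exact (this.eventually_lt_const (lt_add_one _)).mono fun _ h ↦ h.le
  have e4 : ∀ᶠ y in 𝓝 x₀.1, ‖C y‖ ≤ ‖C x₀.1‖ + 1 := by
    have : ContinuousAt (fun y ↦ ‖C y‖) x₀.1 :=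
      (continuous_norm (E := G →L[𝕜] G →L[𝕜] G)).continuousAt.comp hC.continuousAt
    exact (this.eventually_lt_const (lt_add_one _)).mono fun _ h ↦ h.le
  have e5 := hfst.eventually (e1.and (e2.and (e3.and (e4.and hRC))))
  obtain ⟨a, ha, hball'⟩ := Metric.nhds_basis_closedBall.mem_iff.1
    (Filter.inter_mem ht₁ e5)
  let K : NNReal := K₁ + ‖fderiv 𝕜 R x₀.1‖₊ + ‖C x₀.1‖₊ + 1
  have hK : (K : ℝ) = K₁ + ‖fderiv 𝕜 R x₀.1‖ + ‖C x₀.1‖ + 1 := by simp [K]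
  have hK0 : (0 : ℝ) < K := by rw [hK]; positivity
  have hKK : K₁ ≤ K := by
    rw [← NNReal.coe_le_coe, hK]
    have := norm_nonneg (fderiv 𝕜 R x₀.1); have := norm_nonneg (C x₀.1); linarith
  let ε := min (min (ε₀ / 2) 1) (min (1 / (4 * K)) (a / (4 * K)))
  have hε : 0 < ε := by simp only [ε]; positivity
  have hεε : ∀ p : G × (E →L[𝕜] 𝕜), ‖p‖ ≤ ε → p ∈ t₂ := fun p hp ↦ hball (by
    rw [mem_ball_zero_iff]
    have : ε ≤ ε₀ / 2 := (min_le_left _ _).trans (min_le_left _ _)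
    linarith)
  have hL : ∀ p, ‖p‖ ≤ ε → ∀ x ∈ closedBall x₀ a, ‖hamField R C x p‖ ≤ K * ε := by
    intro p hp x hx
    have := hK₁.dist_le_mul (x, p) (htt ⟨(hball' hx).1, hεε p hp⟩) (x, 0)
      (htt ⟨(hball' hx).1, hεε 0 (by simpa using hε.le)⟩)
    have h0 : hamField R C x 0 = 0 := by simp [hamField]
    simp only [h0, dist_zero_right] at this
    refine this.trans ?_
    have : dist (x, p) (x, (0 : G × (E →L[𝕜] 𝕜))) = ‖p‖ := by
      rw [Prod.dist_eq]; simp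
    rw [this]
    gcongr
  refine ⟨a, ε, K, ⟨ha, hε, ?_, ?_, (min_le_left _ _).trans (min_le_right _ _),
    fun x hx ↦ (hball' hx).2.1, ?_, ?_, ?_,
    fun x hx ↦ (hball' hx).2.2.2.2.2, ?_, hL⟩⟩
  · have : ε ≤ 1 / (4 * K) := (min_le_right _ _).trans (min_le_left _ _)
    calc K * ε ≤ K * (1 / (4 * K)) := by gcongr
      _ = 1 / 4 := by field_simp
  · have : ε ≤ a / (4 * K) := (min_le_right _ _).trans (min_le_right _ _)
    calc K * ε ≤ K * (a / (4 * K)) := by gcongr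
      _ = a / 4 := by field_simp
  · intro x hx
    exact (ContinuousAt.comp (g := C) (hball' hx).2.2.1 continuousAt_fst).continuousWithinAt
  · intro x hx
    have := (hball' hx).2.2.2.1
    rw [hK]; have := norm_nonneg (C x₀.1); have := K₁.coe_nonneg; linarith
  · intro x hx
    have := (hball' hx).2.2.2.2.1
    rw [hK]; have := norm_nonneg (fderiv 𝕜 R x₀.1); have := K₁.coe_nonneg; linarith
  · intro p hp
    refine LipschitzOnWith.of_dist_le_mul fun x hx y hy ↦ ?_
    have := hK₁.dist_le_mul (x, p) (htt ⟨(hball' hx).1, hεε p hp⟩) (y, p)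
      (htt ⟨(hball' hy).1, hεε p hp⟩)
    refine this.trans ?_
    have : dist (x, p) (y, p) = dist x y := by rw [Prod.dist_eq]; simp
    rw [this]
    gcongr

/-- The Helffer–Nourrigat cone before taking the closure, in local coordinates: the points `(y, α)`
near which the anchor `R` has constant rank and such that `α` is in the image of the transpose of
`R y`. -/
def regularCone (R : E → G →L[𝕜] E) : Set (E × (G →L[𝕜] 𝕜)) :=
  {x | (∀ᶠ y in 𝓝 x.1, Module.finrank 𝕜 (R y).range = Module.finrank 𝕜 (R x.1).range) ∧
    ∃ ξ : E →L[𝕜] 𝕜, x.2 = ξ ∘L R x.1}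

theorem finrank_range_le_of_ker [FiniteDimensional 𝕜 G] {S T : G →L[𝕜] E} {V : G →L[𝕜] G}
    (hV : Function.Injective V) (h : ∀ k, S k = 0 → T (V k) = 0) :
    Module.finrank 𝕜 T.range ≤ Module.finrank 𝕜 S.range := by
  have h1 := S.toLinearMap.finrank_range_add_finrank_ker
  have h2 := T.toLinearMap.finrank_range_add_finrank_ker
  have h3 : Module.finrank 𝕜 S.ker ≤ Module.finrank 𝕜 T.ker := by
    refine LinearMap.finrank_le_finrank_of_injective
      (f := V.toLinearMap.restrict (p := S.ker) (q := T.ker) fun k hk ↦ h k hk) ?_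
    intro u v huv
    exact Subtype.ext (hV (congrArg Subtype.val huv))
  omega

theorem exists_factor_iff [FiniteDimensional 𝕜 E] (S : G →L[𝕜] E) (α : G →L[𝕜] 𝕜) :
    (∃ ξ : E →L[𝕜] 𝕜, α = ξ ∘L S) ↔ ∀ k, S k = 0 → α k = 0 := by
  constructor
  · rintro ⟨ξ, rfl⟩ k hk
    simp [hk]
  · intro h
    have : α.toLinearMap ∈ S.toLinearMap.dualMap.range := by
      rw [LinearMap.range_dualMap_eq_dualAnnihilator_ker]
      exact (Submodule.mem_dualAnnihilator _).2 h
    obtain ⟨ξ, hξ⟩ := this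
    exact ⟨LinearMap.toContinuousLinearMap ξ, by ext k; exact (LinearMap.congr_fun hξ k).symm⟩

variable [NormedSpace ℝ E]

/-- On `[0, 1]`, the curve `ψ` has derivative `hamField R C ψ p`, the control `p` is continuous
and of norm at most `ε`, and `ψ` stays in the closed ball of radius `a` around `x₀`. -/
structure IsControlled (R : E → G →L[𝕜] E) (C : E → G →L[𝕜] G →L[𝕜] G)
    (x₀ : E × (G →L[𝕜] 𝕜)) (a ε : ℝ) (p : ℝ → G × (E →L[𝕜] 𝕜))
    (ψ : ℝ → E × (G →L[𝕜] 𝕜)) : Prop where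
  continuousOn : ContinuousOn p (Icc 0 1)
  le : ∀ t ∈ Icc (0 : ℝ) 1, ‖p t‖ ≤ ε
  mem : ∀ t ∈ Icc (0 : ℝ) 1, ψ t ∈ closedBall x₀ a
  deriv : ∀ t ∈ Icc (0 : ℝ) 1, HasDerivWithinAt ψ (hamField R C (ψ t) (p t)) (Icc 0 1) t

variable {x₀ : E × (G →L[𝕜] 𝕜)} {a ε : ℝ} {K : NNReal} {p : ℝ → G × (E →L[𝕜] 𝕜)}
    {ψ ψ' : ℝ → E × (G →L[𝕜] 𝕜)}

theorem one_sub_mem_Icc {t : ℝ} (ht : t ∈ Icc (0 : ℝ) 1) : 1 - t ∈ Icc (0 : ℝ) 1 :=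
  ⟨by linarith [ht.2], by linarith [ht.1]⟩

theorem IsControlled.reverse (h : IsControlled R C x₀ a ε p ψ) :
    IsControlled R C x₀ a ε (fun t ↦ -p (1 - t)) (fun t ↦ ψ (1 - t)) where
  continuousOn := (h.continuousOn.comp (by fun_prop) fun t ht ↦ one_sub_mem_Icc ht).neg
  le t ht := by simpa using h.le _ (one_sub_mem_Icc ht)
  mem t ht := h.mem _ (one_sub_mem_Icc ht)
  deriv t ht := by
    have h1 : HasDerivWithinAt (fun t : ℝ ↦ 1 - t) (-1) (Icc 0 1) t := by
      simpa using (hasDerivWithinAt_id t (Icc (0 : ℝ) 1)).const_sub 1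
    have := (h.deriv _ (one_sub_mem_Icc ht)).scomp t h1 fun t ht ↦ one_sub_mem_Icc ht
    simpa [hamField_neg, Function.comp_def] using this

theorem hasDerivWithinAt_Ici_of_Icc {X : Type*} [NormedAddCommGroup X] [NormedSpace ℝ X]
    {f : ℝ → X} {f' : X} {t : ℝ} (h : HasDerivWithinAt f f' (Icc 0 1) t) (ht : t ∈ Ico (0 : ℝ) 1) :
    HasDerivWithinAt f f' (Ici t) t :=
  h.mono_of_mem_nhdsWithin (Filter.mem_of_superset (Icc_mem_nhdsGE ht.2)
    (Icc_subset_Icc_left ht.1))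

/-- Grönwall's inequality for two curves with the same control. -/
theorem IsControlled.dist_le (hb : IsFlowBox R C x₀ a ε K) (h : IsControlled R C x₀ a ε p ψ)
    (h' : IsControlled R C x₀ a ε p ψ') : dist (ψ 1) (ψ' 1) ≤ dist (ψ 0) (ψ' 0) * Real.exp K := by
  have := dist_le_of_trajectories_ODE_of_mem (v := fun t x ↦ hamField R C x (p t)) (K := K)
    (s := fun _ ↦ closedBall x₀ a) (f := ψ) (g := ψ') (a := 0) (b := 1) (δ := dist (ψ 0) (ψ' 0))
    (fun t ht ↦ hb.lipschitz _ (h.le t (Ico_subset_Icc_self ht)))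
    (fun t ht ↦ (h.deriv t ht).continuousWithinAt)
    (fun t ht ↦ hasDerivWithinAt_Ici_of_Icc (h.deriv t (Ico_subset_Icc_self ht)) ht)
    (fun t ht ↦ h.mem t (Ico_subset_Icc_self ht))
    (fun t ht ↦ (h'.deriv t ht).continuousWithinAt)
    (fun t ht ↦ hasDerivWithinAt_Ici_of_Icc (h'.deriv t (Ico_subset_Icc_self ht)) ht)
    (fun t ht ↦ h'.mem t (Ico_subset_Icc_self ht)) le_rfl 1 (by simp)
  simpa using this

/-- Picard-Lindelöf on `[0, 1]`, with the information that the solution stays in the ball. -/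
theorem IsPicardLindelof.exists_solution_mem_closedBall {X : Type*} [NormedAddCommGroup X]
    [NormedSpace ℝ X] [CompleteSpace X] {f : ℝ → X → X} {tmin tmax : ℝ} {t₀ : Icc tmin tmax}
    {x₀ x : X} {a r L K : NNReal} (hf : IsPicardLindelof f t₀ x₀ a r L K)
    (hx : x ∈ closedBall x₀ r) :
    ∃ α : ℝ → X, α t₀ = x ∧ (∀ t, α t ∈ closedBall x₀ a) ∧
      ∀ t ∈ Icc tmin tmax, HasDerivWithinAt α (f t (α t)) (Icc tmin tmax) t := by
  obtain ⟨α, hα⟩ := ODE.FunSpace.exists_isFixedPt_next hf hx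
  refine ⟨α.compProj, by rw [ODE.FunSpace.compProj_val, ← hα, ODE.FunSpace.next_apply₀],
    fun t ↦ α.compProj_mem_closedBall hf.mul_max_le, fun t ht ↦ ?_⟩
  apply ODE.hasDerivWithinAt_picard_Icc t₀.2 hf.continuousOn_uncurry
    α.continuous_compProj.continuousOn (fun _ ht' ↦ α.compProj_mem_closedBall hf.mul_max_le)
    x ht |>.congr_of_mem _ ht
  intro t' ht'
  nth_rw 1 [← hα]
  rw [ODE.FunSpace.compProj_of_mem ht', ODE.FunSpace.next_apply]

/-- Existence of controlled curves, by the Picard–Lindelöf theorem. -/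
theorem exists_isControlled [CompleteSpace E] (hb : IsFlowBox R C x₀ a ε K)
    (hp : ContinuousOn p (Icc 0 1))
    (hpε : ∀ t ∈ Icc (0 : ℝ) 1, ‖p t‖ ≤ ε) {x : E × (G →L[𝕜] 𝕜)}
    (hx : x ∈ closedBall x₀ (a / 2)) : ∃ ψ, IsControlled R C x₀ a ε p ψ ∧ ψ 0 = x := by
  have ha := hb.a_pos
  have hpl : IsPicardLindelof (fun t x ↦ hamField R C x (p t)) (tmin := 0) (tmax := 1)
      ⟨0, by simp⟩ x₀ ⟨a, ha.le⟩ ⟨a / 2, (half_pos ha).le⟩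
      ⟨K * ε, mul_nonneg K.2 hb.ε_pos.le⟩ K := by
    refine ⟨fun t ht ↦ hb.lipschitz _ (hpε t ht), fun x hx ↦ ?_,
      fun t ht x hx ↦ hb.field_le _ (hpε t ht) x hx, ?_⟩
    · simp only [hamField]
      fun_prop
    · have := hb.mul_le'
      simp only [sub_zero, sub_self, max_eq_left zero_le_one, mul_one]
      change K * ε ≤ a - a / 2
      linarith
  obtain ⟨ψ, h0, hψ, hψ'⟩ := hpl.exists_solution_mem_closedBall hx
  exact ⟨ψ, ⟨hp, hpε, fun t _ ↦ hψ t, hψ'⟩, h0⟩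

theorem IsControlled.dist_zero_one_le (hb : IsFlowBox R C x₀ a ε K)
    (h : IsControlled R C x₀ a ε p ψ) : dist (ψ 1) (ψ 0) ≤ a / 4 := by
  have := (convex_Icc (0 : ℝ) 1).norm_image_sub_le_of_norm_hasDerivWithin_le
    (fun t ht ↦ h.deriv t ht) (fun t ht ↦ hb.field_le _ (h.le t ht) _ (h.mem t ht))
    (x := 0) (y := 1) (by simp) (by simp)
  rw [dist_eq_norm]
  have := hb.mul_le'
  simp at *
  linarith

variable [IsScalarTower ℝ 𝕜 E] [NormedSpace ℝ G] [IsScalarTower ℝ 𝕜 G]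

/-- The linear equation `V' = -Q V` with `V 0 = 1` has a solution on `[0, 1]`. If `Q` is small,
`V 1` is so close to the identity that it is injective. -/
theorem exists_linear_transport [CompleteSpace G] {Q : ℝ → G →L[𝕜] G}
    (hQ : ContinuousOn Q (Icc 0 1)) (hQ' : ∀ t ∈ Icc (0 : ℝ) 1, ‖Q t‖ ≤ 1 / 4) :
    ∃ V : ℝ → G →L[𝕜] G, V 0 = 1 ∧ Function.Injective (V 1) ∧
      ∀ t ∈ Icc (0 : ℝ) 1, HasDerivWithinAt V (-(Q t * V t)) (Icc 0 1) t := by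
  have hpl : IsPicardLindelof (fun t V ↦ -(Q t * V)) (tmin := 0) (tmax := 1)
      ⟨0, by simp⟩ (1 : G →L[𝕜] G) (1 / 2) 0 (3 / 8) (1 / 4) := by
    refine ⟨fun t ht ↦ LipschitzOnWith.of_dist_le_mul fun V _ W _ ↦ ?_, fun x hx ↦ ?_,
      fun t ht V hV ↦ ?_, ?_⟩
    · rw [dist_neg_neg, dist_eq_norm, ← mul_sub, dist_eq_norm]
      refine (norm_mul_le _ _).trans ?_
      have := hQ' t ht
      push_cast
      gcongr
    · fun_prop
    · rw [norm_neg]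
      refine (norm_mul_le _ _).trans ?_
      have h1 := hQ' t ht
      have h2 : ‖V‖ ≤ 1 + 1 / 2 := by
        have h3 : ‖V - 1‖ ≤ 1 / 2 := by simpa [dist_eq_norm] using hV
        have h4 : ‖(1 : G →L[𝕜] G)‖ ≤ 1 := ContinuousLinearMap.norm_id_le
        calc ‖V‖ = ‖1 + (V - 1)‖ := by congr 1; abel
          _ ≤ 1 + 1 / 2 := (norm_add_le _ _).trans (add_le_add h4 h3)
      calc ‖Q t‖ * ‖V‖ ≤ 1 / 4 * (1 + 1 / 2) := by gcongr
        _ = ((3 / 8 : NNReal) : ℝ) := by push_cast; norm_num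
    · norm_num
  obtain ⟨V, h0, hV, hV'⟩ := hpl.exists_solution_mem_closedBall (x := 1) (by simp)
  refine ⟨V, h0, fun u v huv ↦ ?_, hV'⟩
  have h3 : ‖V 1 - 1‖ ≤ 1 / 2 := by simpa [dist_eq_norm] using hV 1
  have h4 : ‖(V 1 - 1) (u - v)‖ ≤ 1 / 2 * ‖u - v‖ := ContinuousLinearMap.le_of_opNorm_le _ h3 _
  have h5 : (V 1 - 1) (u - v) = -(u - v) := by simp [huv]
  rw [h5, norm_neg] at h4
  have := norm_nonneg (u - v)
  exact sub_eq_zero.1 (norm_eq_zero.1 (by linarith))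

/-- Transport along a controlled curve `(y, α)`. If `V' = -C(V, p)` with `V 0 = 1`, then
`R y (V k)` satisfies a homogeneous linear equation, by the compatibility of the anchor with
brackets, and so vanishes identically if it vanishes at time `0`. In that case `α (V k)` is
constant. Hence `V 1` maps the kernel of the anchor at the start into the one at the end, compatibly with `α`. -/
theorem IsControlled.exists_transport [CompleteSpace G] (hb : IsFlowBox R C x₀ a ε K)
    (h : IsControlled R C x₀ a ε p ψ) :
    ∃ V : G →L[𝕜] G, Function.Injective V ∧ ∀ k, R (ψ 0).1 k = 0 →
      R (ψ 1).1 (V k) = 0 ∧ (ψ 1).2 (V k) = (ψ 0).2 k := by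
  have hψ : ContinuousOn ψ (Icc 0 1) := fun t ht ↦ (h.deriv t ht).continuousWithinAt
  have hCψ : ContinuousOn (fun t ↦ C (ψ t).1) (Icc 0 1) := hb.continuousOn.comp hψ h.mem
  have hp := h.continuousOn
  obtain ⟨V, hV0, hV1, hV⟩ := exists_linear_transport (Q := fun t ↦ (C (ψ t).1).flip (p t).1)
    (by
      have := (ContinuousLinearMap.flipₗᵢ 𝕜 G G G).continuous.comp_continuousOn hCψ
      exact this.clm_apply (by fun_prop))
    (fun t ht ↦ by
      refine ((C (ψ t).1).flip.le_opNorm _).trans ?_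
      rw [ContinuousLinearMap.opNorm_flip]
      have h1 : ‖(p t).1‖ ≤ ε := (norm_fst_le _).trans (h.le t ht)
      calc _ ≤ K * ε := by gcongr; exact hb.norm_le _ (h.mem t ht)
        _ ≤ 1 / 4 := hb.mul_le)
  refine ⟨V 1, hV1, fun k hk ↦ ?_⟩
  have hVk : ∀ t ∈ Icc (0 : ℝ) 1, HasDerivWithinAt (fun t ↦ V t k)
      (-(C (ψ t).1 (V t k) (p t).1)) (Icc 0 1) t := by
    intro t ht
    exact ((ContinuousLinearMap.apply 𝕜 G k).hasFDerivAt.restrictScalars ℝ).comp_hasDerivWithinAt t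
      (hV t ht)
  have hR : ∀ t ∈ Icc (0 : ℝ) 1, HasDerivWithinAt (fun t ↦ R (ψ t).1 (V t k))
      (-(fderiv 𝕜 R (ψ t).1 (R (ψ t).1 (V t k)) (p t).1)) (Icc 0 1) t := by
    intro t ht
    have h1 : HasFDerivAt (fun z : E × G ↦ R z.1 z.2) _ ((ψ t).1, V t k) :=
      HasFDerivAt.clm_apply
        ((hb.differentiableAt _ (h.mem t ht)).hasFDerivAt.comp ((ψ t).1, V t k) hasFDerivAt_fst)
        hasFDerivAt_snd
    have h2 := HasFDerivAt.comp_hasDerivWithinAt (𝕜 := ℝ) t (f := fun t ↦ ((ψ t).1, V t k))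
      (h1.restrictScalars ℝ)
      (((ContinuousLinearMap.fst ℝ E (G →L[𝕜] 𝕜)).hasFDerivAt.comp_hasDerivWithinAt t
        (h.deriv t ht)).prodMk (hVk t ht))
    refine h2.congr_deriv ?_
    have := hb.structure_eq _ (h.mem t ht) (V t k) (p t).1
    simp [hamField, this]
    abel
  have hα : ∀ t ∈ Icc (0 : ℝ) 1, HasDerivWithinAt (fun t ↦ (ψ t).2 (V t k))
      ((p t).2 (R (ψ t).1 (V t k))) (Icc 0 1) t := by
    intro t ht
    have h1 : HasFDerivAt (fun z : (G →L[𝕜] 𝕜) × G ↦ z.1 z.2) _ ((ψ t).2, V t k) :=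
      HasFDerivAt.clm_apply hasFDerivAt_fst hasFDerivAt_snd
    have h2 := HasFDerivAt.comp_hasDerivWithinAt (𝕜 := ℝ) t (f := fun t ↦ ((ψ t).2, V t k))
      (h1.restrictScalars ℝ)
      (((ContinuousLinearMap.snd ℝ E (G →L[𝕜] 𝕜)).hasFDerivAt.comp_hasDerivWithinAt t
        (h.deriv t ht)).prodMk (hVk t ht))
    refine h2.congr_deriv ?_
    simp [hamField]
  have hR0 : ∀ t ∈ Icc (0 : ℝ) 1, R (ψ t).1 (V t k) = 0 := by
    refine eq_zero_of_abs_deriv_le_mul_abs_self_of_eq_zero_right (K := K)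
      (fun t ht ↦ (hR t ht).continuousWithinAt)
      (fun t ht ↦ hasDerivWithinAt_Ici_of_Icc (hR t (Ico_subset_Icc_self ht)) ht)
      (by simp [hV0, hk]) fun t ht ↦ ?_
    have ht := Ico_subset_Icc_self ht
    rw [norm_neg]
    have h1 : ‖(p t).1‖ ≤ 1 := (norm_fst_le _).trans ((h.le t ht).trans hb.ε_le)
    calc _ ≤ ‖fderiv 𝕜 R (ψ t).1‖ * ‖R (ψ t).1 (V t k)‖ * ‖(p t).1‖ :=
          ContinuousLinearMap.le_opNorm₂ _ _ _
      _ ≤ K * ‖R (ψ t).1 (V t k)‖ * 1 := by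
          gcongr
          exact hb.fderiv_le _ (h.mem t ht)
      _ = _ := by ring
  refine ⟨hR0 1 (by simp), ?_⟩
  have := eq_zero_of_abs_deriv_le_mul_abs_self_of_eq_zero_right (K := 0) (a := 0) (b := 1)
      (f := fun t ↦ (ψ t).2 (V t k) - (ψ 0).2 k)
      (fun t ht ↦ ((hα t ht).sub_const _).continuousWithinAt)
      (fun t ht ↦ hasDerivWithinAt_Ici_of_Icc
        ((hα t (Ico_subset_Icc_self ht)).sub_const ((ψ 0).2 k)) ht)
      (by simp [hV0]) (fun t ht ↦ by simp [hR0 t (Ico_subset_Icc_self ht)]) 1 (by simp)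
  simpa [sub_eq_zero] using this

/-- The transports along the curve and along the reversed curve compare the ranks. -/
theorem IsControlled.finrank_eq [FiniteDimensional 𝕜 G] (hb : IsFlowBox R C x₀ a ε K)
    (h : IsControlled R C x₀ a ε p ψ) :
    Module.finrank 𝕜 (R (ψ 1).1).range = Module.finrank 𝕜 (R (ψ 0).1).range := by
  have := FiniteDimensional.complete 𝕜 G
  obtain ⟨V, hV, hV'⟩ := h.exists_transport hb
  obtain ⟨W, hW, hW'⟩ := h.reverse.exists_transport hb
  simp only [sub_zero, sub_self] at hW'
  exact le_antisymm (finrank_range_le_of_ker hV fun k hk ↦ (hV' k hk).1)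
    (finrank_range_le_of_ker hW fun k hk ↦ (hW' k hk).1)

/-- The rank of the anchor is constant near the end of a controlled curve if it is constant near the
start: the points near the end flow back to points near the start with the same rank. -/
theorem IsControlled.mem_regularCone [FiniteDimensional 𝕜 E] [FiniteDimensional 𝕜 G]
    (hb : IsFlowBox R C x₀ a ε K) (h : IsControlled R C x₀ a ε p ψ)
    (hx₀ : ψ 0 ∈ ball x₀ (a / 4)) (hψ : ψ 0 ∈ regularCone R) : ψ 1 ∈ regularCone R := by
  have := FiniteDimensional.complete 𝕜 G
  have := FiniteDimensional.complete 𝕜 E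
  have h1 : ψ 1 ∈ ball x₀ (a / 2) := by
    have := h.dist_zero_one_le hb
    have := dist_triangle (ψ 1) (ψ 0) x₀
    rw [mem_ball] at *
    linarith
  refine ⟨?_, ?_⟩
  · have h2 : ∀ᶠ x in 𝓝 (ψ 1), x ∈ ball x₀ (a / 2) := isOpen_ball.mem_nhds h1
    obtain ⟨δ, hδ, hδ'⟩ := Metric.eventually_nhds_iff.1
      ((continuousAt_fst (p := ψ 0)).eventually hψ.1)
    have h3 : ∀ᶠ x in 𝓝 (ψ 1), dist x (ψ 1) * Real.exp K < δ := by
      have : Filter.Tendsto (fun x ↦ dist x (ψ 1) * Real.exp K) (𝓝 (ψ 1)) (𝓝 0) := by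
        have : Continuous fun x ↦ dist x (ψ 1) * Real.exp K := by fun_prop
        simpa using this.tendsto (ψ 1)
      exact this.eventually_lt_const hδ
    have h4 : ∀ᶠ x in 𝓝 (ψ 1), Module.finrank 𝕜 (R x.1).range =
        Module.finrank 𝕜 (R (ψ 1).1).range := by
      filter_upwards [h2, h3] with x hx hx'
      obtain ⟨χ, hχ, rfl⟩ := exists_isControlled hb h.reverse.continuousOn h.reverse.le
        (ball_subset_closedBall hx)
      rw [← hχ.finrank_eq hb, h.finrank_eq hb]
      apply hδ'
      have := hχ.dist_le hb h.reverse
      simp only [sub_zero, sub_self] at this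
      linarith
    have h5 := (Continuous.prodMk_left (ψ 1).2).continuousAt (x := (ψ 1).1) |>.eventually h4
    exact h5
  · rw [exists_factor_iff]
    intro k hk
    obtain ⟨V, -, hV⟩ := h.reverse.exists_transport hb
    simp only [sub_zero, sub_self] at hV
    rw [← (hV k hk).2]
    exact (exists_factor_iff _ _).1 hψ.2 _ (hV k hk).1

/-- The closure is invariant because the solutions with the same control depend continuously on the
starting point. -/
theorem IsControlled.mem_closure_regularCone [FiniteDimensional 𝕜 E] [FiniteDimensional 𝕜 G]
    (hb : IsFlowBox R C x₀ a ε K) (h : IsControlled R C x₀ a ε p ψ)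
    (hx₀ : ψ 0 = x₀) (hψ : x₀ ∈ closure (regularCone R)) :
    ψ 1 ∈ closure (regularCone R) := by
  have := FiniteDimensional.complete 𝕜 E
  have ha := hb.a_pos
  rw [Metric.mem_closure_iff] at hψ ⊢
  intro δ hδ
  obtain ⟨x, hx, hx'⟩ := hψ (min (a / 4) (δ * Real.exp (-K))) (by positivity)
  have hxa : x ∈ ball x₀ (a / 4) := by
    rw [mem_ball, dist_comm]; exact hx'.trans_le (min_le_left _ _)
  obtain ⟨χ, hχ, rfl⟩ := exists_isControlled hb h.continuousOn h.le (x := x)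
    (closedBall_subset_closedBall (by linarith) (ball_subset_closedBall hxa))
  refine ⟨χ 1, hχ.mem_regularCone hb hxa hx, (h.dist_le hb hχ).trans_lt ?_⟩
  calc _ < δ * Real.exp (-K) * Real.exp K := by
        rw [hx₀]; gcongr; exact hx'.trans_le (min_le_right _ _)
    _ = δ := by rw [mul_assoc, ← Real.exp_add]; simp

end Core

section ComplexTime

open Metric Set

/-- A curve `Ψ`, in real or in complex time, with `Ψ' = hamField R C Ψ p` that starts in the
closure of the regular cone stays there for small times. Complex time reduces to real time: the
restriction of `Ψ` to the segment from `t₀` to `t₀ + c` solves the same equation with control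
`c • p`, which is small if `c` is. -/
theorem eventually_mem_closure_regularCone {𝕜 E G : Type*} [RCLike 𝕜]
    [NormedAddCommGroup E] [NormedSpace 𝕜 E] [FiniteDimensional 𝕜 E]
    [NormedAddCommGroup G] [NormedSpace 𝕜 G] [FiniteDimensional 𝕜 G]
    {R : E → G →L[𝕜] E} {C : E → G →L[𝕜] G →L[𝕜] G} {Ψ : 𝕜 → E × (G →L[𝕜] 𝕜)}
    {p : 𝕜 → G × (E →L[𝕜] 𝕜)} {t₀ : 𝕜} (hR : ContDiffAt 𝕜 1 R (Ψ t₀).1)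
    (hC : ContDiffAt 𝕜 1 C (Ψ t₀).1)
    (hRC : ∀ᶠ y in 𝓝 (Ψ t₀).1, ∀ v w, R y (C y v w) =
      fderiv 𝕜 R y (R y v) w - fderiv 𝕜 R y (R y w) v)
    (h : ∀ᶠ t in 𝓝 t₀, ContinuousAt p t ∧ HasDerivAt Ψ (hamField R C (Ψ t) (p t)) t)
    (hΨ : Ψ t₀ ∈ closure (regularCone R)) : ∀ᶠ t in 𝓝 t₀, Ψ t ∈ closure (regularCone R) := by
  let _ : NormedSpace ℝ E := NormedSpace.restrictScalars ℝ 𝕜 E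
  let _ : NormedSpace ℝ G := NormedSpace.restrictScalars ℝ 𝕜 G
  have : IsScalarTower ℝ 𝕜 E := RestrictScalars.isScalarTower ℝ 𝕜 E
  have : IsScalarTower ℝ 𝕜 G := RestrictScalars.isScalarTower ℝ 𝕜 G
  obtain ⟨a, ε, K, hb⟩ := exists_isFlowBox (Ψ t₀) hR hC hRC
  have h₀ := h.self_of_nhds
  have h1 : ∀ᶠ t in 𝓝 t₀, Ψ t ∈ closedBall (Ψ t₀) a :=
    h₀.2.continuousAt (closedBall_mem_nhds _ hb.a_pos)
  have h2 : ∀ᶠ t in 𝓝 t₀, ‖p t‖ < ‖p t₀‖ + 1 :=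
    (continuous_norm.continuousAt.comp h₀.1).eventually_lt continuousAt_const (by simp)
  obtain ⟨r, hr, hr'⟩ := Metric.eventually_nhds_iff_ball.1 (h.and (h1.and h2))
  have hB : 0 < ‖p t₀‖ + 1 := by positivity
  -- The second bound on `‖t - t₀‖` makes the control `(t - t₀) • p` of norm at most `ε`.
  filter_upwards [ball_mem_nhds t₀ (lt_min hr (div_pos hb.ε_pos hB))] with t ht
  set c := t - t₀ with hc
  have hcr : ‖c‖ < min r (ε / (‖p t₀‖ + 1)) := by rwa [mem_ball_iff_norm] at ht
  let σ : ℝ → 𝕜 := fun τ ↦ t₀ + (τ : 𝕜) * c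
  have hσ : ∀ τ ∈ Icc (0 : ℝ) 1, σ τ ∈ ball t₀ r := by
    intro τ hτ
    rw [mem_ball_iff_norm]
    simp only [σ, add_sub_cancel_left, norm_mul, RCLike.norm_ofReal, abs_of_nonneg hτ.1]
    calc τ * ‖c‖ ≤ 1 * ‖c‖ := by gcongr; exact hτ.2
      _ < r := by rw [one_mul]; exact hcr.trans_le (min_le_left _ _)
  have hσ' : ∀ τ, HasDerivAt σ c τ := fun τ ↦ by
    have := ((RCLike.ofRealCLM (K := 𝕜)).hasDerivAt (x := τ)).mul_const c
    simpa [σ] using this.const_add t₀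
  have hctr : IsControlled R C (Ψ t₀) a ε (fun τ ↦ c • p (σ τ)) (fun τ ↦ Ψ (σ τ)) := by
    refine ⟨?_, ?_, fun τ hτ ↦ (hr' _ (hσ τ hτ)).2.1, fun τ hτ ↦ ?_⟩
    · intro τ hτ
      exact (((hr' _ (hσ τ hτ)).1.1.comp (f := σ)
        (hσ' τ).continuousAt).const_smul c).continuousWithinAt
    · intro τ hτ
      rw [norm_smul]
      calc ‖c‖ * ‖p (σ τ)‖ ≤ ε / (‖p t₀‖ + 1) * (‖p t₀‖ + 1) := by
            gcongr
            · exact (norm_nonneg c).trans (hcr.le.trans (min_le_right _ _))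
            · exact hcr.le.trans (min_le_right _ _)
            · exact (hr' _ (hσ τ hτ)).2.2.le
        _ = ε := div_mul_cancel₀ _ hB.ne'
    · rw [hamField_smul]
      exact ((hr' _ (hσ τ hτ)).1.2.scomp τ (hσ' τ)).hasDerivWithinAt
  have := hctr.mem_closure_regularCone hb (by simp [σ]) hΨ
  simpa [σ, hc] using this

/-- A solution of a time-dependent equation `Ψ' = hamField R C Ψ p`, in real or in complex time,
can neither enter nor leave the closure of the cone. -/
theorem eventually_mem_closure_regularCone_iff {𝕜 E G : Type*} [RCLike 𝕜]
    [NormedAddCommGroup E] [NormedSpace 𝕜 E] [FiniteDimensional 𝕜 E]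
    [NormedAddCommGroup G] [NormedSpace 𝕜 G] [FiniteDimensional 𝕜 G]
    {R : E → G →L[𝕜] E} {C : E → G →L[𝕜] G →L[𝕜] G} {Ψ : 𝕜 → E × (G →L[𝕜] 𝕜)}
    {p : 𝕜 → G × (E →L[𝕜] 𝕜)} {t₀ : 𝕜} (hR : ContDiffAt 𝕜 1 R (Ψ t₀).1)
    (hC : ContDiffAt 𝕜 1 C (Ψ t₀).1)
    (hRC : ∀ᶠ y in 𝓝 (Ψ t₀).1, ∀ v w, R y (C y v w) =
      fderiv 𝕜 R y (R y v) w - fderiv 𝕜 R y (R y w) v)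
    (h : ∀ᶠ t in 𝓝 t₀, ContinuousAt p t ∧ HasDerivAt Ψ (hamField R C (Ψ t) (p t)) t) :
    ∀ᶠ t in 𝓝 t₀, (Ψ t₀ ∈ closure (regularCone R) ↔ Ψ t ∈ closure (regularCone R)) := by
  by_cases hΨ : Ψ t₀ ∈ closure (regularCone R)
  · filter_upwards [eventually_mem_closure_regularCone hR hC hRC h hΨ] with t ht
    simp [hΨ, ht]
  · filter_upwards [h.self_of_nhds.2.continuousAt (isClosed_closure.isOpen_compl.mem_nhds hΨ)]
      with t ht
    exact iff_of_false hΨ ht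

end ComplexTime

/-! ### The anchor in local coordinates -/

section Coordinates

open Set

variable {𝕜 : Type*} [RCLike 𝕜] {n : WithTop ℕ∞}
    {E : Type*} [NormedAddCommGroup E] [NormedSpace 𝕜 E]
    {M : Type*} [TopologicalSpace M]
    [ChartedSpace E M]
    {FA : Type*} [NormedAddCommGroup FA] [NormedSpace 𝕜 FA]
    {A : M → Type*} [TopologicalSpace (TotalSpace FA A)]
    [∀ x, AddCommGroup (A x)] [∀ x, Module 𝕜 (A x)] [∀ x, TopologicalSpace (A x)]
    [FiberBundle FA A] [VectorBundle 𝕜 FA A]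

variable (E FA A) in
/-- The points of the domain of the chart at `m₀` over which the trivialization of `A` at `m₀` is
defined. -/
def coordDomain (m₀ : M) : Opens M :=
  ⟨(chartAt E m₀).source ∩ (trivializationAt FA A m₀).baseSet,
    (chartAt E m₀).open_source.inter (trivializationAt FA A m₀).open_baseSet⟩

theorem mem_coordDomain (m₀ : M) : m₀ ∈ coordDomain E FA A m₀ :=
  ⟨mem_chart_source E m₀, FiberBundle.mem_baseSet_trivializationAt' m₀⟩

variable (𝕜 FA A) in
/-- The local section of `A` which is constant, equal to `v`, in the trivialization at `m₀`. -/
def frameSection (m₀ : M) (v : FA) (x : M) : A x := (trivializationAt FA A m₀).symmL 𝕜 x v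

theorem isSectionOn_frameSection [ContMDiffVectorBundle n FA A 𝓘(𝕜, E)] (m₀ : M) (v : FA) :
    IsSectionOn 𝓘(𝕜, E) n FA (coordDomain E FA A m₀) (frameSection 𝕜 FA A m₀ v) := by
  refine ((trivializationAt FA A m₀).contMDiffOn_section_iff (n := n) (IB := 𝓘(𝕜, E))
    (coordDomain E FA A m₀).2 fun x hx ↦ hx.2).2 ?_
  refine (contMDiffOn_const (c := v)).congr fun x hx ↦ ?_
  rw [frameSection, Trivialization.symmL_apply _ hx.2, Trivialization.apply_mk_symm _ hx.2]

/-- The derivative at `x` of the chart at `m₀`. -/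
def chartDeriv (m₀ x : M) : TangentSpace 𝓘(𝕜, E) x →L[𝕜] E :=
  mfderiv 𝓘(𝕜, E) 𝓘(𝕜, E) (extChartAt 𝓘(𝕜, E) m₀) x

variable (FA) in
/-- The anchor at `x`, read in the chart and the trivialization at `m₀`. -/
def anchorAt (ρ : Π x : M, A x →L[𝕜] TangentSpace 𝓘(𝕜, E) x) (m₀ x : M) : FA →L[𝕜] E :=
  (chartDeriv m₀ x ∘L ρ x) ∘L (trivializationAt FA A m₀).symmL 𝕜 x

variable (FA) in
/-- The anchor in the chart and the trivialization at `m₀`, as a function on the model space. -/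
def anchorCoord (ρ : Π x : M, A x →L[𝕜] TangentSpace 𝓘(𝕜, E) x) (m₀ : M) (y : E) : FA →L[𝕜] E :=
  anchorAt FA ρ m₀ ((extChartAt 𝓘(𝕜, E) m₀).symm y)

/-- The chart of the total space of `A^*` defined by the chart of `M` and the trivialization of
`A` at `m₀`. -/
def dualCoord (m₀ : M) (α : DualBundle 𝕜 FA A) : E × (FA →L[𝕜] 𝕜) :=
  (extChartAt 𝓘(𝕜, E) m₀ α.1, α.2 ∘L (trivializationAt FA A m₀).symmL 𝕜 α.1)

variable {ρ : Π x : M, A x →L[𝕜] TangentSpace 𝓘(𝕜, E) x} {m₀ : M}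

theorem anchorCoord_extChartAt {x : M} (hx : x ∈ coordDomain E FA A m₀) (v : FA) :
    anchorCoord FA ρ m₀ (extChartAt 𝓘(𝕜, E) m₀ x) v =
      chartDeriv m₀ x (ρ x (frameSection 𝕜 FA A m₀ v x)) := by
  have : (extChartAt 𝓘(𝕜, E) m₀).symm (extChartAt 𝓘(𝕜, E) m₀ x) = x :=
    (extChartAt 𝓘(𝕜, E) m₀).left_inv (by simpa using hx.1)
  rw [anchorCoord, this]
  rfl

theorem isInvertible_chartDeriv [IsManifold 𝓘(𝕜, E) 1 M] {x : M}
    (hx : x ∈ coordDomain E FA A m₀) :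
    (chartDeriv (𝕜 := 𝕜) (E := E) m₀ x).IsInvertible :=
  isInvertible_mfderiv_extChartAt (by simpa using hx.1)

theorem contDiffAt_anchorCoord [FiniteDimensional 𝕜 FA]
    [IsManifold 𝓘(𝕜, E) 1 M] [IsManifold 𝓘(𝕜, E) ∞ M] [IsManifold 𝓘(𝕜, E) n M] (hn : ∞ ≤ n)
    [ContMDiffVectorBundle n FA A 𝓘(𝕜, E)]
    (hρ : IsBundleMorphism 𝓘(𝕜, E) n FA ρ) {x : M} (hx : x ∈ coordDomain E FA A m₀) :
    ContDiffAt 𝕜 ∞ (anchorCoord FA ρ m₀) (extChartAt 𝓘(𝕜, E) m₀ x) := by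
  set W := (extChartAt 𝓘(𝕜, E) m₀).target ∩
    (extChartAt 𝓘(𝕜, E) m₀).symm ⁻¹' (coordDomain E FA A m₀) with hW
  have hWo : IsOpen W := (continuousOn_extChartAt_symm m₀).isOpen_inter_preimage
    (isOpen_extChartAt_target m₀) (coordDomain E FA A m₀).2
  have hsrc : x ∈ (extChartAt 𝓘(𝕜, E) m₀).source := by simpa using hx.1
  have hxW : extChartAt 𝓘(𝕜, E) m₀ x ∈ W :=
    ⟨(extChartAt 𝓘(𝕜, E) m₀).map_source hsrc, by
      rw [mem_preimage, (extChartAt 𝓘(𝕜, E) m₀).left_inv hsrc]; exact hx⟩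
  refine ContDiffOn.contDiffAt ?_ (hWo.mem_nhds hxW)
  rw [contDiffOn_clm_apply]
  intro v
  have h1 : ContMDiffOn 𝓘(𝕜, E) 𝓘(𝕜, E).tangent ∞
      (fun x ↦ (⟨x, ρ x (frameSection 𝕜 FA A m₀ v x)⟩ : TangentBundle 𝓘(𝕜, E) M))
      (coordDomain E FA A m₀) :=
    (hρ.comp_contMDiffOn (isSectionOn_frameSection m₀ v)).of_le hn
  have h2 := ((trivializationAt E (TangentSpace 𝓘(𝕜, E)) m₀).contMDiffOn_section_iff
    (n := ∞) (IB := 𝓘(𝕜, E))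
    (coordDomain E FA A m₀).2 (fun x hx ↦ hx.1)).1 h1
  have h3 : ContMDiffOn 𝓘(𝕜, E) 𝓘(𝕜, E) ∞
      (fun x ↦ chartDeriv m₀ x (ρ x (frameSection 𝕜 FA A m₀ v x)))
      (coordDomain E FA A m₀) := by
    refine h2.congr fun y hy ↦ ?_
    have h := TangentBundle.continuousLinearMapAt_trivializationAt (I := 𝓘(𝕜, E)) (x₀ := m₀) hy.1
    have hy' : y ∈ (trivializationAt E (TangentSpace 𝓘(𝕜, E)) m₀).baseSet := hy.1
    refine (DFunLike.congr_fun h (ρ y (frameSection 𝕜 FA A m₀ v y))).symm.trans ?_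
    rw [Trivialization.continuousLinearMapAt_apply, Trivialization.coe_linearMapAt_of_mem _ hy']
  have h4 := h3.comp ((contMDiffOn_extChartAt_symm (n := ∞) m₀).mono inter_subset_left)
    (fun y hy ↦ hy.2)
  exact contMDiffOn_iff_contDiffOn.1 h4

variable (FA) in
/-- The vector field `ρ(a)`, for the section `a` of constant coordinates `v`, in the chart at
`m₀`. -/
def anchorField (ρ : Π x : M, A x →L[𝕜] TangentSpace 𝓘(𝕜, E) x) (m₀ : M) (v : FA) (y : E) :
    TangentSpace 𝓘(𝕜, E) y := anchorCoord FA ρ m₀ y v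

theorem mpullback_anchorField [IsManifold 𝓘(𝕜, E) 1 M] {x : M} (hx : x ∈ coordDomain E FA A m₀)
    (v : FA) :
    VectorField.mpullback 𝓘(𝕜, E) 𝓘(𝕜, E) (extChartAt 𝓘(𝕜, E) m₀)
      (anchorField FA ρ m₀ v) x = ρ x (frameSection 𝕜 FA A m₀ v x) := by
  rw [VectorField.mpullback_apply]
  refine (isInvertible_chartDeriv hx).inverse_apply_eq.2 ?_
  exact anchorCoord_extChartAt hx v

/-- The bracket of the vector fields defined by two sections with constant coordinates, in the
chart. -/
theorem chartDeriv_mlieBracket [FiniteDimensional 𝕜 E] [FiniteDimensional 𝕜 FA]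
    [IsManifold 𝓘(𝕜, E) 1 M] [IsManifold 𝓘(𝕜, E) ∞ M] [IsManifold 𝓘(𝕜, E) n M] (hn : ∞ ≤ n)
    [ContMDiffVectorBundle n FA A 𝓘(𝕜, E)]
    (hρ : IsBundleMorphism 𝓘(𝕜, E) n FA ρ) {x : M} (hx : x ∈ coordDomain E FA A m₀) (v w : FA) :
    chartDeriv m₀ x (VectorField.mlieBracket 𝓘(𝕜, E)
        (fun y ↦ ρ y (frameSection 𝕜 FA A m₀ v y)) (fun y ↦ ρ y (frameSection 𝕜 FA A m₀ w y)) x) =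
      fderiv 𝕜 (anchorCoord FA ρ m₀) (extChartAt 𝓘(𝕜, E) m₀ x)
          (anchorCoord FA ρ m₀ (extChartAt 𝓘(𝕜, E) m₀ x) v) w -
        fderiv 𝕜 (anchorCoord FA ρ m₀) (extChartAt 𝓘(𝕜, E) m₀ x)
          (anchorCoord FA ρ m₀ (extChartAt 𝓘(𝕜, E) m₀ x) w) v := by
  have := FiniteDimensional.complete 𝕜 E
  have hmin : minSmoothness 𝕜 2 = 2 := minSmoothness_of_isRCLikeNormedField
  have : IsManifold 𝓘(𝕜, E) (minSmoothness 𝕜 2) M := by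
    rw [hmin]; infer_instance
  have : IsManifold 𝓘(𝕜, E) (minSmoothness 𝕜 2) E := by
    rw [hmin]; infer_instance
  have hR := (contDiffAt_anchorCoord hn hρ hx).differentiableAt (by simp)
  have hX : ∀ v, MDifferentiableAt 𝓘(𝕜, E) 𝓘(𝕜, E).tangent
      (fun y ↦ (⟨y, anchorField FA ρ m₀ v y⟩ : TangentBundle 𝓘(𝕜, E) E))
      (extChartAt 𝓘(𝕜, E) m₀ x) := by
    intro v
    have h1 : ContDiffAt 𝕜 1 (fun y ↦ anchorCoord FA ρ m₀ y v) (extChartAt 𝓘(𝕜, E) m₀ x) :=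
      ((contDiffAt_anchorCoord hn hρ hx).clm_apply contDiffAt_const).of_le (by simp)
    exact (contMDiffAt_vectorSpace_iff_contDiffAt.2 h1).mdifferentiableAt (by simp)
  have hev : ∀ v, (fun y ↦ ρ y (frameSection 𝕜 FA A m₀ v y)) =ᶠ[𝓝 x]
      VectorField.mpullback 𝓘(𝕜, E) 𝓘(𝕜, E) (extChartAt 𝓘(𝕜, E) m₀)
        (anchorField FA ρ m₀ v) := by
    intro v
    filter_upwards [(coordDomain E FA A m₀).2.mem_nhds hx] with y hy
    exact (mpullback_anchorField hy v).symm
  rw [(hev v).mlieBracket_vectorField_eq (hev w),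
    ← VectorField.mpullback_mlieBracket (n := 2) (hX v) (hX w) (contMDiffAt_extChartAt' hx.1) hmin.le,
    VectorField.mpullback_apply,
    ← VectorField.mlieBracketWithin_univ, VectorField.mlieBracketWithin_eq_lieBracketWithin]
  refine ((isInvertible_chartDeriv hx).self_apply_inverse _).trans ?_
  change fderivWithin 𝕜 (fun y ↦ anchorCoord FA ρ m₀ y w) univ _ (anchorCoord FA ρ m₀ _ v) -
    fderivWithin 𝕜 (fun y ↦ anchorCoord FA ρ m₀ y v) univ _ (anchorCoord FA ρ m₀ _ w) = _
  rw [fderivWithin_univ, fderivWithin_univ, fderiv_clm_apply hR (differentiableAt_const w),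
    fderiv_clm_apply hR (differentiableAt_const v)]
  simp

theorem exists_frameSection_eq {x : M} (hx : x ∈ coordDomain E FA A m₀) (u : A x) :
    ∃ v, frameSection 𝕜 FA A m₀ v x = u :=
  ⟨(trivializationAt FA A m₀).continuousLinearMapAt 𝕜 x u,
    (trivializationAt FA A m₀).symmL_continuousLinearMapAt hx.2 u⟩

/-- The tangent space of the leaf is the image of the anchor. -/
theorem IsAnchoredBundle.tangent_eq_range [IsManifold 𝓘(𝕜, E) 1 M]
    [ContMDiffVectorBundle n FA A 𝓘(𝕜, E)] {F : SingularFoliation 𝓘(𝕜, E) n M}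
    (hρ : IsAnchoredBundle FA F ρ) (x : M) : F.tangent x = (ρ x).range := by
  apply le_antisymm
  · refine Submodule.span_le.2 ?_
    rintro _ ⟨U, hxU, X, hX, rfl⟩
    obtain ⟨V, hxV, -, a, -, ha⟩ := (hρ.image_eq U X).1 hX x hxU
    exact ⟨a x, ha x hxV⟩
  · rintro _ ⟨u, rfl⟩
    obtain ⟨v, rfl⟩ := exists_frameSection_eq (𝕜 := 𝕜) (E := E) (FA := FA) (mem_coordDomain x) u
    refine Submodule.subset_span ⟨coordDomain E FA A x, mem_coordDomain x,
      fun y ↦ ρ y (frameSection 𝕜 FA A x v y), ?_, rfl⟩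
    exact (hρ.image_eq _ _).2 fun y hy ↦ ⟨_, hy, le_rfl, _, isSectionOn_frameSection x v,
      fun _ _ ↦ rfl⟩

theorem finrank_range_anchorCoord [IsManifold 𝓘(𝕜, E) 1 M] {x : M}
    (hx : x ∈ coordDomain E FA A m₀) :
    Module.finrank 𝕜 (anchorCoord FA ρ m₀ (extChartAt 𝓘(𝕜, E) m₀ x)).range =
      Module.finrank 𝕜 (ρ x).range := by
  obtain ⟨e, he⟩ := isInvertible_chartDeriv (𝕜 := 𝕜) hx
  have : (anchorCoord FA ρ m₀ (extChartAt 𝓘(𝕜, E) m₀ x)).range =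
      (ρ x).range.map (e.toLinearEquiv : TangentSpace 𝓘(𝕜, E) x →ₗ[𝕜] E) := by
    ext y
    simp only [Submodule.mem_map, LinearMap.mem_range, ContinuousLinearMap.coe_coe]
    constructor
    · rintro ⟨v, rfl⟩
      refine ⟨_, ⟨frameSection 𝕜 FA A m₀ v x, rfl⟩, ?_⟩
      rw [anchorCoord_extChartAt hx, ← he]
      rfl
    · rintro ⟨_, ⟨u, rfl⟩, rfl⟩
      obtain ⟨v, rfl⟩ := exists_frameSection_eq (𝕜 := 𝕜) hx u
      refine ⟨v, ?_⟩
      rw [anchorCoord_extChartAt hx, ← he]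
      rfl
  rw [this]
  exact LinearEquiv.finrank_map_eq _ _

/-- The chart of `A^*` maps the union of the images of the transposes of the anchor over the regular
points to `regularCone`. -/
theorem mem_regularCone_iff [IsManifold 𝓘(𝕜, E) 1 M]
    [ContMDiffVectorBundle n FA A 𝓘(𝕜, E)] {F : SingularFoliation 𝓘(𝕜, E) n M}
    (hρ : IsAnchoredBundle FA F ρ) (α : DualBundle 𝕜 FA A) (hα : α.1 ∈ coordDomain E FA A m₀) :
    dualCoord m₀ α ∈ regularCone (anchorCoord FA ρ m₀) ↔ α.1 ∈ F.regular ∧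
      ∃ ξ : TangentSpace 𝓘(𝕜, E) α.1 →L[𝕜] 𝕜, ∀ u : A α.1, α.2 u = ξ (ρ α.1 u) := by
  have hsrc : α.1 ∈ (extChartAt 𝓘(𝕜, E) m₀).source := by simpa using hα.1
  have hleft := (extChartAt 𝓘(𝕜, E) m₀).left_inv hsrc
  refine and_congr ?_ ?_
  · have h0 : ∀ x ∈ coordDomain E FA A m₀, Module.finrank 𝕜 (F.tangent x) =
        Module.finrank 𝕜 (anchorCoord FA ρ m₀ (extChartAt 𝓘(𝕜, E) m₀ x)).range := by
      intro x hx
      rw [finrank_range_anchorCoord hx, hρ.tangent_eq_range]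
    change (∀ᶠ y in 𝓝 (extChartAt 𝓘(𝕜, E) m₀ α.1), Module.finrank 𝕜 (anchorCoord FA ρ m₀ y).range =
      Module.finrank 𝕜 (anchorCoord FA ρ m₀ (extChartAt 𝓘(𝕜, E) m₀ α.1)).range) ↔
      ∀ᶠ x in 𝓝 α.1, Module.finrank 𝕜 (F.tangent x) = Module.finrank 𝕜 (F.tangent α.1)
    rw [h0 _ hα]
    constructor
    · intro h
      filter_upwards [(continuousAt_extChartAt' hsrc).eventually h,
        (coordDomain E FA A m₀).2.mem_nhds hα] with x hx hx'
      rw [← hx, h0 x hx']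
    · intro h
      have hc := continuousAt_extChartAt_symm' hsrc
      rw [ContinuousAt, hleft] at hc
      filter_upwards [hc.eventually h, hc.eventually ((coordDomain E FA A m₀).2.mem_nhds hα),
        extChartAt_target_mem_nhds' ((extChartAt 𝓘(𝕜, E) m₀).map_source hsrc)] with y hy hy' hy''
      rw [← hy, h0 _ hy', (extChartAt 𝓘(𝕜, E) m₀).right_inv hy'']
  · obtain ⟨e, he⟩ := isInvertible_chartDeriv (𝕜 := 𝕜) hα
    constructor
    · rintro ⟨ξ, hξ⟩
      refine ⟨ξ ∘L chartDeriv m₀ α.1, fun u ↦ ?_⟩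
      obtain ⟨v, rfl⟩ := exists_frameSection_eq (𝕜 := 𝕜) hα u
      have := DFunLike.congr_fun hξ v
      refine this.trans ?_
      exact congrArg ξ (anchorCoord_extChartAt hα v)
    · rintro ⟨ξ, hξ⟩
      refine ⟨ξ ∘L (e.symm : E →L[𝕜] TangentSpace 𝓘(𝕜, E) α.1), ?_⟩
      ext v
      refine (hξ (frameSection 𝕜 FA A m₀ v α.1)).trans ?_
      simp only [dualCoord, ContinuousLinearMap.comp_apply, anchorCoord_extChartAt hα, ← he]
      simp

end Coordinates

/-! ### Differentials of functions pulled back under immersions -/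

section Pullback

variable {𝕜 : Type*} [RCLike 𝕜]
    {Z : Type*} [NormedAddCommGroup Z] [NormedSpace 𝕜 Z] [FiniteDimensional 𝕜 Z]
    {Y : Type*} [NormedAddCommGroup Y] [NormedSpace 𝕜 Y] [FiniteDimensional 𝕜 Y]

/-- Near a point where `f` is an immersion, the differential of a function `h` factors through the
differential of `f`, with a factor `κ` that depends continuously on the point. -/
theorem exists_factor_fderiv {f : Z → Y} {h : Z → 𝕜} {z₀ : Z} (hf : ContDiffAt 𝕜 1 f z₀)
    (hh : ContDiffAt 𝕜 1 h z₀) (hinj : Function.Injective (fderiv 𝕜 f z₀)) :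
    ∃ κ : Z → Y →L[𝕜] 𝕜, ∀ᶠ z in 𝓝 z₀, ContinuousAt κ z ∧
      fderiv 𝕜 h z = κ z ∘L fderiv 𝕜 f z := by
  have := FiniteDimensional.complete 𝕜 Z
  obtain ⟨S', hS'⟩ := (fderiv 𝕜 f z₀).toLinearMap.exists_leftInverse_of_injective
    (LinearMap.ker_eq_bot.2 hinj)
  let S : Y →L[𝕜] Z := LinearMap.toContinuousLinearMap S'
  have hS : S ∘L fderiv 𝕜 f z₀ = 1 := by
    ext v
    exact LinearMap.congr_fun hS' v
  have hf' : ∀ᶠ z in 𝓝 z₀, ContinuousAt (fderiv 𝕜 f) z :=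
    (hf.eventually (by simp)).mono fun z hz ↦
      (hz.fderiv_right (m := 0) (by simp)).continuousAt
  have hh' : ∀ᶠ z in 𝓝 z₀, ContinuousAt (fderiv 𝕜 h) z :=
    (hh.eventually (by simp)).mono fun z hz ↦
      (hz.fderiv_right (m := 0) (by simp)).continuousAt
  have hu : ∀ᶠ z in 𝓝 z₀, IsUnit (S ∘L fderiv 𝕜 f z) := by
    have hc : ContinuousAt (fun z ↦ S ∘L fderiv 𝕜 f z) z₀ :=
      continuousAt_const.clm_comp hf'.self_of_nhds
    exact hc.eventually (Units.isOpen.mem_nhds (by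
      change IsUnit (S ∘L fderiv 𝕜 f z₀)
      rw [hS]; exact isUnit_one))
  refine ⟨fun z ↦ (fderiv 𝕜 h z ∘L Ring.inverse (S ∘L fderiv 𝕜 f z)) ∘L S, ?_⟩
  filter_upwards [hf', hh', hu] with z h1 h2 h3
  refine ⟨?_, ?_⟩
  · obtain ⟨u, hu⟩ := h3
    have h4 : ContinuousAt (fun z ↦ Ring.inverse (S ∘L fderiv 𝕜 f z)) z := by
      have h5 : ContinuousAt (Ring.inverse : (Z →L[𝕜] Z) → Z →L[𝕜] Z) (S ∘L fderiv 𝕜 f z) := by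
        rw [← hu]; exact NormedRing.inverse_continuousAt u
      exact ContinuousAt.comp (f := fun z ↦ S ∘L fderiv 𝕜 f z) h5
        (continuousAt_const.clm_comp h1)
    exact (h2.clm_comp h4).clm_comp continuousAt_const
  · have h4 : Ring.inverse (S ∘L fderiv 𝕜 f z) * (S ∘L fderiv 𝕜 f z) = 1 :=
      Ring.inverse_mul_cancel _ h3
    ext v
    exact congrArg (fderiv 𝕜 h z) (DFunLike.congr_fun h4 v).symm

end Pullback

/-! ### The cone in the charts of the dual bundle -/

section DualChart

open Set

variable {𝕜 : Type*} [RCLike 𝕜] {n : WithTop ℕ∞}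
    {E : Type*} [NormedAddCommGroup E] [NormedSpace 𝕜 E]
    {M : Type*} [TopologicalSpace M]
    [ChartedSpace E M]
    {FA : Type*} [NormedAddCommGroup FA] [NormedSpace 𝕜 FA]
    {A : M → Type*} [TopologicalSpace (TotalSpace FA A)]
    [∀ x, AddCommGroup (A x)] [∀ x, Module 𝕜 (A x)] [∀ x, TopologicalSpace (A x)]
    [∀ x, IsTopologicalAddGroup (A x)] [∀ x, ContinuousSMul 𝕜 (A x)]
    [FiberBundle FA A] [VectorBundle 𝕜 FA A]

theorem chartAt_dual_apply (α₀ α : DualBundle 𝕜 FA A) :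
    chartAt (ModelProd E (FA →L[𝕜] 𝕜)) α₀ α = dualCoord α₀.1 α := by
  rw [FiberBundle.chartedSpace_chartAt]
  refine Prod.ext ?_ ?_
  · simp [dualCoord]
    rfl
  · ext v
    simp [dualCoord, hom_trivializationAt_apply, ContinuousLinearMap.inCoordinates]
    rfl

theorem chartAt_dual_source (α₀ : DualBundle 𝕜 FA A) :
    (chartAt (ModelProd E (FA →L[𝕜] 𝕜)) α₀).source = {α | α.1 ∈ coordDomain E FA A α₀.1} := by
  rw [FiberBundle.chartedSpace_chartAt]
  ext α
  simp [coordDomain]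
  exact and_comm

theorem extChartAt_dual_apply (α₀ α : DualBundle 𝕜 FA A) :
    extChartAt (𝓘(𝕜, E).prod 𝓘(𝕜, FA →L[𝕜] 𝕜)) α₀ α = dualCoord α₀.1 α := by
  rw [← chartAt_dual_apply]
  rfl

/-- The chart of `A^*` maps the Helffer–Nourrigat cone to the closure of `regularCone`. -/
theorem mem_closure_regularCone_iff [IsManifold 𝓘(𝕜, E) 1 M]
    [ContMDiffVectorBundle n FA A 𝓘(𝕜, E)] {F : SingularFoliation 𝓘(𝕜, E) n M}
    {ρ : Π x : M, A x →L[𝕜] TangentSpace 𝓘(𝕜, E) x}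
    (hρ : IsAnchoredBundle FA F ρ) {m₀ : M} {α : DualBundle 𝕜 FA A}
    (hα : α.1 ∈ coordDomain E FA A m₀) :
    dualCoord m₀ α ∈ closure (regularCone (anchorCoord FA ρ m₀)) ↔
      α ∈ helfferNourrigatCone FA F ρ := by
  let α₀ : DualBundle 𝕜 FA A := ⟨m₀, 0⟩
  have : (chartAt (ModelProd E (FA →L[𝕜] 𝕜)) α₀).IsImage
      {α | α.1 ∈ F.regular ∧
        ∃ ξ : TangentSpace 𝓘(𝕜, E) α.1 →L[𝕜] 𝕜, ∀ u : A α.1, α.2 u = ξ (ρ α.1 u)}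
      (regularCone (anchorCoord FA ρ m₀)) := by
    intro α hα
    rw [chartAt_dual_source] at hα
    rw [chartAt_dual_apply]
    exact mem_regularCone_iff hρ α hα
  have h2 := this.closure (x := α) (by rw [chartAt_dual_source]; exact hα)
  rw [chartAt_dual_apply] at h2
  exact h2

end DualChart

/-! ### Quotients of pulled back Lie algebroids -/

/-- The bilinear maps with given values on a basis, as a continuous linear function of these
values. -/
theorem Module.Basis.exists_bilinear {𝕜 G κ : Type*} [NontriviallyNormedField 𝕜]
    [CompleteSpace 𝕜] [NormedAddCommGroup G] [NormedSpace 𝕜 G] [FiniteDimensional 𝕜 G] [Fintype κ]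
    (b : Module.Basis κ 𝕜 G) :
    ∃ Θ : (κ → κ → G) →L[𝕜] G →L[𝕜] G →L[𝕜] G, ∀ d i j, Θ d (b i) (b j) = d i j := by
  let Θ₁ : (κ → G) →ₗ[𝕜] G →L[𝕜] G :=
    LinearMap.toContinuousLinearMap.toLinearMap ∘ₗ (b.constr 𝕜).toLinearMap
  let Θ₂ : (κ → G →L[𝕜] G) →ₗ[𝕜] G →L[𝕜] G →L[𝕜] G :=
    LinearMap.toContinuousLinearMap.toLinearMap ∘ₗ (b.constr 𝕜).toLinearMap
  refine ⟨LinearMap.toContinuousLinearMap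
    (Θ₂ ∘ₗ LinearMap.pi fun i ↦ Θ₁ ∘ₗ LinearMap.proj i), fun d i j ↦ ?_⟩
  classical
  simp [Θ₁, Θ₂]

theorem Module.Basis.bilinear_apply_eq {𝕜 G ι : Type*} [NontriviallyNormedField 𝕜]
    [NormedAddCommGroup G] [NormedSpace 𝕜 G] (b : Module.Basis ι 𝕜 G)
    (T : G →ₗ[𝕜] G →ₗ[𝕜] 𝕜) (c : G →L[𝕜] G →L[𝕜] G) (y : G →L[𝕜] 𝕜)
    (h : ∀ i j, T (b i) (b j) = y (c (b i) (b j))) (v w : G) : T v w = y (c v w) := by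
  let T₂ : G →ₗ[𝕜] G →ₗ[𝕜] 𝕜 := LinearMap.mk₂ 𝕜 (fun v w ↦ y (c v w))
    (by simp) (by simp) (by simp) (by simp)
  have hT : T = T₂ := b.ext fun i ↦ b.ext fun j ↦ h i j
  exact LinearMap.congr_fun₂ hT v w

section Quotient

open Set

variable {𝕜 : Type*} [RCLike 𝕜] {n : WithTop ℕ∞}
    {E : Type*} [NormedAddCommGroup E] [NormedSpace 𝕜 E]
    {M : Type*} [TopologicalSpace M]
    [ChartedSpace E M]
    {FA : Type*} [NormedAddCommGroup FA] [NormedSpace 𝕜 FA]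
    {A : M → Type*} [TopologicalSpace (TotalSpace FA A)]
    [∀ x, AddCommGroup (A x)] [∀ x, Module 𝕜 (A x)] [∀ x, TopologicalSpace (A x)]
    [∀ x, IsTopologicalAddGroup (A x)] [∀ x, ContinuousSMul 𝕜 (A x)]
    [FiberBundle FA A] [VectorBundle 𝕜 FA A]
    {EL : Type*} [NormedAddCommGroup EL] [NormedSpace 𝕜 EL]
    {L : Type*} [TopologicalSpace L] [ChartedSpace EL L]
    {FB : Type*} [NormedAddCommGroup FB] [NormedSpace 𝕜 FB]
    {B : L → Type*} [TopologicalSpace (TotalSpace FB B)]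
    [∀ l, AddCommGroup (B l)] [∀ l, Module 𝕜 (B l)] [∀ l, TopologicalSpace (B l)]
    [∀ l, IsTopologicalAddGroup (B l)] [∀ l, ContinuousSMul 𝕜 (B l)]
    [FiberBundle FB B] [VectorBundle 𝕜 FB B]

variable (FA) in
/-- The Lie algebroid `B` over the manifold `L`, immersed in `M` by `ι`, is a quotient of the
pullback of the anchored bundle `A` by means of `q`. The bundle `A` need not carry a global
bracket: it suffices that the bracket of the sections of `B` induced by `a` and `b` is induced by
some local section `c` with `ρ(c) = [ρ(a), ρ(b)]`. This covers Lie algebroid structures on `A`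
itself, with the identity as `ι` and `q`, as well as the holonomy Lie algebroid of a leaf. -/
structure IsQuotientAlgebroid [IsManifold 𝓘(𝕜, E) 1 M] [IsManifold 𝓘(𝕜, EL) 1 L] (n : WithTop ℕ∞)
    (ρ : Π x : M, A x →L[𝕜] TangentSpace 𝓘(𝕜, E) x) (ι : L → M)
    (q : Π l : L, A (ι l) →L[𝕜] B l) {σ : Π l : L, B l →L[𝕜] TangentSpace 𝓘(𝕜, EL) l}
    (h : LieAlgebroid 𝓘(𝕜, EL) n FB σ) : Prop where
  contMDiff : ContMDiff 𝓘(𝕜, EL) 𝓘(𝕜, E) n ι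
  immersion : ∀ l, Function.Injective (mfderiv 𝓘(𝕜, EL) 𝓘(𝕜, E) ι l)
  isSectionOn : ∀ (U : Opens M) (V : Opens L) (a : Π x : M, A x), (∀ l ∈ V, ι l ∈ U) →
    IsSectionOn 𝓘(𝕜, E) n FA U a → IsSectionOn 𝓘(𝕜, EL) n FB V (fun l ↦ q l (a (ι l)))
  surjective : ∀ l, Function.Surjective (q l)
  anchor : ∀ l (u : A (ι l)), mfderiv 𝓘(𝕜, EL) 𝓘(𝕜, E) ι l (σ l (q l u)) = ρ (ι l) u
  bracket : ∀ (U : Opens M) (a b : Π x : M, A x), IsSectionOn 𝓘(𝕜, E) n FA U a →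
    IsSectionOn 𝓘(𝕜, E) n FA U b → ∀ m ∈ U, ∃ V : Opens M, m ∈ V ∧
      ∃ c : Π x : M, A x, IsSectionOn 𝓘(𝕜, E) n FA V c ∧
        (∀ x ∈ V, ρ x (c x) =
          VectorField.mlieBracket 𝓘(𝕜, E) (fun y ↦ ρ y (a y)) (fun y ↦ ρ y (b y)) x) ∧
        ∀ l, ι l ∈ V →
          h.bracket (fun k ↦ q k (a (ι k))) (fun k ↦ q k (b (ι k))) l = q l (c (ι l))

variable [IsManifold 𝓘(𝕜, E) 1 M] [IsManifold 𝓘(𝕜, EL) 1 L]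
    {ρ : Π x : M, A x →L[𝕜] TangentSpace 𝓘(𝕜, E) x} {ι : L → M}
    {q : Π l : L, A (ι l) →L[𝕜] B l} {σ : Π l : L, B l →L[𝕜] TangentSpace 𝓘(𝕜, EL) l}
    {h : LieAlgebroid 𝓘(𝕜, EL) n FB σ}

/-- Near `m₀` there are structure functions `C` compatible with the anchor, which induce the
brackets of the sections of `B` that come from sections of `A` with constant coordinates. -/
theorem IsQuotientAlgebroid.exists_structure [FiniteDimensional 𝕜 E] [FiniteDimensional 𝕜 FA]
    [IsManifold 𝓘(𝕜, E) ∞ M] [IsManifold 𝓘(𝕜, E) n M] [ContMDiffVectorBundle n FA A 𝓘(𝕜, E)]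
    (hq : IsQuotientAlgebroid FA n ρ ι q h) (hn : ∞ ≤ n)
    (hρ : IsBundleMorphism 𝓘(𝕜, E) n FA ρ) (m₀ : M) :
    ∃ (W : Opens M) (C : E → FA →L[𝕜] FA →L[𝕜] FA), m₀ ∈ W ∧ W ≤ coordDomain E FA A m₀ ∧
      ContDiffAt 𝕜 1 C (extChartAt 𝓘(𝕜, E) m₀ m₀) ∧
      (∀ x ∈ W, ∀ v w, anchorCoord FA ρ m₀ (extChartAt 𝓘(𝕜, E) m₀ x)
          (C (extChartAt 𝓘(𝕜, E) m₀ x) v w) =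
        fderiv 𝕜 (anchorCoord FA ρ m₀) (extChartAt 𝓘(𝕜, E) m₀ x)
            (anchorCoord FA ρ m₀ (extChartAt 𝓘(𝕜, E) m₀ x) v) w -
          fderiv 𝕜 (anchorCoord FA ρ m₀) (extChartAt 𝓘(𝕜, E) m₀ x)
            (anchorCoord FA ρ m₀ (extChartAt 𝓘(𝕜, E) m₀ x) w) v) ∧
      ∀ l, ι l ∈ W → ∀ i j : Fin (Module.finrank 𝕜 FA),
        h.bracket (fun k ↦ q k (frameSection 𝕜 FA A m₀ (Module.finBasis 𝕜 FA i) (ι k)))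
          (fun k ↦ q k (frameSection 𝕜 FA A m₀ (Module.finBasis 𝕜 FA j) (ι k))) l =
        q l (frameSection 𝕜 FA A m₀ (C (extChartAt 𝓘(𝕜, E) m₀ (ι l)) (Module.finBasis 𝕜 FA i)
          (Module.finBasis 𝕜 FA j)) (ι l)) := by
  let b := Module.finBasis 𝕜 FA
  have H := fun i j ↦ hq.bracket _ _ _
    (isSectionOn_frameSection (E := E) (A := A) (n := n) m₀ (b i))
    (isSectionOn_frameSection m₀ (b j)) m₀ (mem_coordDomain m₀)
  choose V hV c hc hρc hbr using H
  let V' : Opens M := ⟨interior (⋂ i, ⋂ j, (V i j : Set M)), isOpen_interior⟩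
  have hV' : ∀ i j, V' ≤ V i j := fun i j x hx ↦
    mem_iInter.1 (mem_iInter.1 (interior_subset hx) i) j
  have hmV' : m₀ ∈ V' := by
    refine mem_interior_iff_mem_nhds.2 ?_
    exact Filter.iInter_mem.2 fun i ↦ Filter.iInter_mem.2 fun j ↦ (V i j).2.mem_nhds (hV i j)
  let W := V' ⊓ coordDomain E FA A m₀
  let e := trivializationAt FA A m₀
  let φ := extChartAt 𝓘(𝕜, E) m₀
  obtain ⟨Θ, hΘ⟩ := b.exists_bilinear
  let d : M → Fin (Module.finrank 𝕜 FA) → Fin (Module.finrank 𝕜 FA) → FA :=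
    fun x i j ↦ (e ⟨x, c i j x⟩).2
  let C : E → FA →L[𝕜] FA →L[𝕜] FA := fun y ↦ Θ (d (φ.symm y))
  have hCb : ∀ x ∈ W, ∀ i j, C (φ x) (b i) (b j) = (e ⟨x, c i j x⟩).2 := by
    intro x hx i j
    have : φ.symm (φ x) = x := φ.left_inv (by simpa [φ] using hx.2.1)
    simp only [C, hΘ, this]
    rfl
  have hfr : ∀ x ∈ W, ∀ i j, frameSection 𝕜 FA A m₀ (C (φ x) (b i) (b j)) x = c i j x := by
    intro x hx i j
    rw [hCb x hx, frameSection, Trivialization.symmL_apply _ hx.2.2]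
    exact Trivialization.symm_apply_apply_mk _ hx.2.2 _
  refine ⟨W, C, ⟨hmV', mem_coordDomain m₀⟩, inf_le_right, ?_, ?_, ?_⟩
  · have h1 : ∀ i j, ContDiffAt 𝕜 1 (fun y ↦ (e ⟨φ.symm y, c i j (φ.symm y)⟩).2) (φ m₀) := by
      intro i j
      have hcW : ContMDiffOn 𝓘(𝕜, E) (𝓘(𝕜, E).prod 𝓘(𝕜, FA)) n
          (fun x ↦ (⟨x, c i j x⟩ : TotalSpace FA A)) W :=
        (hc i j).mono fun x hx ↦ hV' i j hx.1
      have h2 := (e.contMDiffOn_section_iff (n := n) (IB := 𝓘(𝕜, E)) W.2 fun x hx ↦ hx.2.2).1 hcW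
      have h3 : ContMDiffAt 𝓘(𝕜, E) 𝓘(𝕜, FA) n (fun x ↦ (e ⟨x, c i j x⟩).2) m₀ :=
        h2.contMDiffAt (W.2.mem_nhds ⟨hmV', mem_coordDomain m₀⟩)
      have h4 := (contMDiffAt_iff.1 h3).2
      simp only [modelWithCornersSelf_coe, range_id, contDiffWithinAt_univ] at h4
      exact ContDiffAt.of_le h4 (le_trans (by simp) hn)
    exact Θ.contDiff.contDiffAt.comp (φ m₀) (contDiffAt_pi.2 fun i ↦ contDiffAt_pi.2 fun j ↦ h1 i j)
  · intro x hx v w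
    let R := anchorCoord FA ρ m₀
    let D := fderiv 𝕜 R (φ x)
    have key : ∀ i j, R (φ x) (C (φ x) (b i) (b j)) =
        D (R (φ x) (b i)) (b j) - D (R (φ x) (b j)) (b i) := by
      intro i j
      rw [← chartDeriv_mlieBracket hn hρ hx.2, ← hρc i j x (hV' i j hx.1), ← hfr x hx]
      exact anchorCoord_extChartAt hx.2 _
    let T₁ : FA →ₗ[𝕜] FA →ₗ[𝕜] E := LinearMap.mk₂ 𝕜 (fun v w ↦ R (φ x) (C (φ x) v w))
      (by simp) (by simp) (by simp) (by simp)
    let T₂ : FA →ₗ[𝕜] FA →ₗ[𝕜] E := LinearMap.mk₂ 𝕜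
      (fun v w ↦ D (R (φ x) v) w - D (R (φ x) w) v)
      (by intros; simp; abel) (by intros; simp [smul_sub]) (by intros; simp; abel)
      (by intros; simp [smul_sub])
    have hT : T₁ = T₂ := b.ext fun i ↦ b.ext fun j ↦ key i j
    exact LinearMap.congr_fun₂ hT v w
  · intro l hl i j
    rw [hbr i j l (hV' i j hl.1), hfr (ι l) hl i j]

theorem LieAlgebroid.isQuotientAlgebroid_id (g : LieAlgebroid 𝓘(𝕜, E) n FA ρ) :
    IsQuotientAlgebroid FA n ρ (id : M → M) (fun x ↦ ContinuousLinearMap.id 𝕜 (A x)) g where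
  contMDiff := contMDiff_id
  immersion l := by
    rw [mfderiv_id]
    exact Function.injective_id
  isSectionOn U V a hV ha := ha.mono hV
  surjective l := Function.surjective_id
  anchor l u := by
    rw [mfderiv_id]
    rfl
  bracket U a b ha hb m hm := ⟨U, hm, g.bracket a b, g.isSectionOn U a b ha hb,
    g.anchor_bracket U a b ha hb, fun l _ ↦ rfl⟩

theorem IsHolonomyLieAlgebroid.isQuotientAlgebroid {F : SingularFoliation 𝓘(𝕜, E) n M}
    (hρ : IsAnchoredBundle FA F ρ) (hι : F.IsLeaf 𝓘(𝕜, EL) ι)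
    (hq : IsHolonomyLieAlgebroid FA ρ ι q h) : IsQuotientAlgebroid FA n ρ ι q h where
  contMDiff := hι.contMDiff
  immersion := hι.immersion
  isSectionOn := hq.isSectionOn
  surjective := hq.surjective
  anchor := hq.anchor
  bracket U a b ha hb m hm := by
    have hF : ∀ a : Π x : M, A x, IsSectionOn 𝓘(𝕜, E) n FA U a →
        (fun x ↦ ρ x (a x)) ∈ F.sections U := fun a ha ↦
      (hρ.image_eq _ _).2 fun x hx ↦ ⟨U, hx, le_rfl, a, ha, fun _ _ ↦ rfl⟩
    obtain ⟨V, hmV, hVU, c, hc, hρc⟩ :=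
      (hρ.image_eq _ _).1 (F.lie_mem U _ (hF a ha) _ (hF b hb)) m hm
    exact ⟨V, hmV, c, hc, hρc, hq.bracket V a b c (ha.mono hVU) (hb.mono hVU) hc hρc⟩

/-- The map `B^* → A^*` defined by the transpose of `q`, in the chart of `A^*` at `m₀`. -/
def pullCoord (ι : L → M) (q : Π l : L, A (ι l) →L[𝕜] B l) (m₀ : M) (p : DualBundle 𝕜 FB B) :
    E × (FA →L[𝕜] 𝕜) :=
  dualCoord m₀ ⟨ι p.1, p.2 ∘L q p.1⟩

/-- The quotient map over `l`, in the trivializations of `A` at `ι l₀` and of `B` at `l₀`. -/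
def quotientAt (q : Π l : L, A (ι l) →L[𝕜] B l) (l₀ l : L) : FA →L[𝕜] FB :=
  ((trivializationAt FB B l₀).continuousLinearMapAt 𝕜 l ∘L q l) ∘L
    (trivializationAt FA A (ι l₀)).symmL 𝕜 (ι l)

theorem IsQuotientAlgebroid.contDiffAt_quotientAt [FiniteDimensional 𝕜 FA]
    [IsManifold 𝓘(𝕜, EL) ∞ L] [IsManifold 𝓘(𝕜, EL) n L] [ContMDiffVectorBundle n FA A 𝓘(𝕜, E)]
    [ContMDiffVectorBundle n FB B 𝓘(𝕜, EL)]
    (hq : IsQuotientAlgebroid FA n ρ ι q h) (hn : ∞ ≤ n) (l₀ : L) :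
    ContDiffAt 𝕜 1 (fun z ↦ quotientAt (FA := FA) (FB := FB) q l₀ ((extChartAt 𝓘(𝕜, EL) l₀).symm z))
      (extChartAt 𝓘(𝕜, EL) l₀ l₀) := by
  let V : Opens L := ⟨ι ⁻¹' (coordDomain E FA A (ι l₀)),
    (coordDomain E FA A (ι l₀)).2.preimage hq.contMDiff.continuous⟩ ⊓ coordDomain EL FB B l₀
  set W := (extChartAt 𝓘(𝕜, EL) l₀).target ∩ (extChartAt 𝓘(𝕜, EL) l₀).symm ⁻¹' V with hW
  have hWo : IsOpen W := (continuousOn_extChartAt_symm l₀).isOpen_inter_preimage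
    (isOpen_extChartAt_target l₀) V.2
  have hlW : extChartAt 𝓘(𝕜, EL) l₀ l₀ ∈ W :=
    ⟨mem_extChartAt_target l₀, by
      rw [mem_preimage, extChartAt_to_inv]
      exact ⟨mem_coordDomain (ι l₀), mem_coordDomain l₀⟩⟩
  refine ContDiffOn.contDiffAt ?_ (hWo.mem_nhds hlW)
  rw [contDiffOn_clm_apply]
  intro v
  have h1 := (hq.isSectionOn (coordDomain E FA A (ι l₀)) V _ (fun l hl ↦ hl.1)
    (isSectionOn_frameSection (ι l₀) v))
  have h2 := ((trivializationAt FB B l₀).contMDiffOn_section_iff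
    (n := n) (IB := 𝓘(𝕜, EL)) V.2 (fun x hx ↦ hx.2.2)).1 h1
  have h3 : ContMDiffOn 𝓘(𝕜, EL) 𝓘(𝕜, FB) 1
      (fun l ↦ quotientAt (FA := FA) (FB := FB) q l₀ l v) V := by
    refine (h2.of_le (le_trans (by simp) hn)).congr fun l hl ↦ ?_
    exact (trivializationAt FB B l₀).continuousLinearMapAt_apply_of_mem 𝕜 hl.2.2 _
  have h4 := h3.comp ((contMDiffOn_extChartAt_symm (n := 1) l₀).mono inter_subset_left)
    (fun y hy ↦ hy.2)
  exact contMDiffOn_iff_contDiffOn.1 h4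

theorem IsQuotientAlgebroid.surjective_quotientAt
    (hq : IsQuotientAlgebroid FA n ρ ι q h) (l₀ : L) :
    Function.Surjective (quotientAt (FA := FA) (FB := FB) q l₀ l₀) := by
  intro w
  obtain ⟨u, hu⟩ := hq.surjective l₀ ((trivializationAt FB B l₀).symmL 𝕜 l₀ w)
  obtain ⟨v, rfl⟩ := exists_frameSection_eq (𝕜 := 𝕜) (E := E) (FA := FA)
    (mem_coordDomain (ι l₀)) u
  refine ⟨v, ?_⟩
  refine (congrArg _ hu).trans ?_
  exact (trivializationAt FB B l₀).continuousLinearMapAt_symmL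
    (FiberBundle.mem_baseSet_trivializationAt' l₀) w

/-- In the charts, the map `B^* → A^*` defined by the transpose of `q` is an immersion, as `ι` is an
immersion and `q` is surjective. -/
theorem IsQuotientAlgebroid.exists_immersion [FiniteDimensional 𝕜 FA]
    [IsManifold 𝓘(𝕜, EL) ∞ L] [IsManifold 𝓘(𝕜, EL) n L] [ContMDiffVectorBundle n FA A 𝓘(𝕜, E)]
    [ContMDiffVectorBundle n FB B 𝓘(𝕜, EL)]
    (hq : IsQuotientAlgebroid FA n ρ ι q h) (hn : ∞ ≤ n) (p₀ : DualBundle 𝕜 FB B) :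
    ∃ f : EL × (FB →L[𝕜] 𝕜) → E × (FA →L[𝕜] 𝕜),
      ContDiffAt 𝕜 1 f (dualCoord p₀.1 p₀) ∧
      Function.Injective (fderiv 𝕜 f (dualCoord p₀.1 p₀)) ∧
      ∀ p : DualBundle 𝕜 FB B, p.1 ∈ coordDomain EL FB B p₀.1 →
        pullCoord ι q (ι p₀.1) p = f (dualCoord p₀.1 p) := by
  set l₀ := p₀.1 with hl₀
  let χ := extChartAt 𝓘(𝕜, EL) l₀
  let F : EL → E := extChartAt 𝓘(𝕜, E) (ι l₀) ∘ ι ∘ χ.symm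
  let N : EL → FA →L[𝕜] FB := fun z ↦ quotientAt (FA := FA) (FB := FB) q l₀ (χ.symm z)
  have hι : ContMDiffAt 𝓘(𝕜, EL) 𝓘(𝕜, E) 1 ι l₀ :=
    (hq.contMDiff l₀).of_le (le_trans (by simp) hn)
  have hF : ContDiffAt 𝕜 1 F (χ l₀) := by
    have := (contMDiffAt_iff.1 hι).2
    simpa only [modelWithCornersSelf_coe, range_id, contDiffWithinAt_univ] using this
  have hF' : Function.Injective (fderiv 𝕜 F (χ l₀)) := by
    have h1 := hq.immersion l₀
    rw [(hι.mdifferentiableAt (by simp)).mfderiv] at h1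
    simp only [modelWithCornersSelf_coe, range_id, fderivWithin_univ] at h1
    exact h1
  have hN : ContDiffAt 𝕜 1 N (χ l₀) := hq.contDiffAt_quotientAt hn l₀
  have hp₀ : (dualCoord l₀ p₀).1 = χ l₀ := rfl
  have hF₁ : HasFDerivAt (fun z : EL × (FB →L[𝕜] 𝕜) ↦ F z.1) _ (dualCoord l₀ p₀) :=
    HasFDerivAt.comp (g := F) _ (hF.differentiableAt (by simp)).hasFDerivAt hasFDerivAt_fst
  have hN₁ : HasFDerivAt (fun z : EL × (FB →L[𝕜] 𝕜) ↦ N z.1) _ (dualCoord l₀ p₀) :=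
    HasFDerivAt.comp (g := N) _ (hN.differentiableAt (by simp)).hasFDerivAt hasFDerivAt_fst
  have hf := hF₁.prodMk (HasFDerivAt.clm_comp
    (hasFDerivAt_snd (𝕜 := 𝕜) (p := dualCoord l₀ p₀)) hN₁)
  refine ⟨fun z ↦ (F z.1, z.2 ∘L N z.1), ?_, ?_, ?_⟩
  · refine ContDiffAt.prodMk (ContDiffAt.comp (g := F) (dualCoord l₀ p₀) hF contDiffAt_fst)
      (contDiffAt_snd.clm_comp (ContDiffAt.comp (g := N) (dualCoord l₀ p₀) hN contDiffAt_fst))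
  · rw [hf.fderiv]
    refine (injective_iff_map_eq_zero _).2 ?_
    rintro ⟨u, β⟩ hu
    have h1 : fderiv 𝕜 F (χ l₀) u = 0 := congrArg Prod.fst hu
    have h2 : u = 0 := hF' (by rw [h1, map_zero])
    subst h2
    have h3 := congrArg Prod.snd hu
    have h4 : β ∘L N (χ l₀) = 0 := by simpa [hp₀] using h3
    have h5 : N (χ l₀) = quotientAt (FA := FA) (FB := FB) q l₀ l₀ := by
      simp only [N, χ, extChartAt_to_inv]
    refine Prod.ext rfl ?_
    ext w
    obtain ⟨v, rfl⟩ := hq.surjective_quotientAt l₀ w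
    rw [← h5]
    exact DFunLike.congr_fun h4 v
  · intro p hp
    have hx : χ.symm (χ p.1) = p.1 := χ.left_inv (by simpa [χ] using hp.1)
    refine Prod.ext ?_ ?_
    · simp only [pullCoord, dualCoord, F, Function.comp]
      rw [hx]
    · simp only [pullCoord, dualCoord, N]
      rw [hx]
      ext v
      simp only [quotientAt, ContinuousLinearMap.comp_apply]
      rw [(trivializationAt FB B l₀).symmL_continuousLinearMapAt hp.2]

/-! ### Hamiltonian vector fields in the charts of the dual bundle -/

section Control

variable (E FA)

/-- The linear function `(y, α) ↦ α v` on `E × FA^*`. -/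
def evalAt (v : FA) : E × (FA →L[𝕜] 𝕜) →L[𝕜] 𝕜 :=
  ContinuousLinearMap.apply 𝕜 𝕜 v ∘L ContinuousLinearMap.snd 𝕜 E (FA →L[𝕜] 𝕜)

variable {E FA}

/-- The components `(v, π)` of the linear function `κ = (y, α) ↦ π y + α v` on `E × FA^*`. -/
def covectorControl [FiniteDimensional 𝕜 FA] (κ : E × (FA →L[𝕜] 𝕜) →L[𝕜] 𝕜) :
    FA × (E →L[𝕜] 𝕜) :=
  (∑ i, κ (0, LinearMap.toContinuousLinearMap ((Module.finBasis 𝕜 FA).coord i)) •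
    Module.finBasis 𝕜 FA i, κ ∘L ContinuousLinearMap.inl 𝕜 E (FA →L[𝕜] 𝕜))

theorem continuous_covectorControl [FiniteDimensional 𝕜 FA] :
    Continuous (covectorControl : (E × (FA →L[𝕜] 𝕜) →L[𝕜] 𝕜) → FA × (E →L[𝕜] 𝕜)) := by
  unfold covectorControl
  fun_prop

theorem eq_covectorControl [FiniteDimensional 𝕜 FA] (κ : E × (FA →L[𝕜] 𝕜) →L[𝕜] 𝕜) :
    κ = (covectorControl κ).2 ∘L ContinuousLinearMap.fst 𝕜 E (FA →L[𝕜] 𝕜) +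
      evalAt E FA (covectorControl κ).1 := by
  let b := Module.finBasis 𝕜 FA
  have h1 : ∀ x : FA →L[𝕜] 𝕜, κ (0, x) = x (covectorControl κ).1 := by
    intro x
    have hx : x = ∑ i, x (b i) • LinearMap.toContinuousLinearMap (b.coord i) := by
      ext v
      have hv : x v = ∑ i, b.repr v i * x (b i) := by
        conv_lhs => rw [← b.sum_repr v]
        simp only [map_sum, map_smul, smul_eq_mul]
      simp only [hv, sum_apply, smul_apply, LinearMap.coe_toContinuousLinearMap',
        Module.Basis.coord_apply, smul_eq_mul, mul_comm]
    have h2 : κ (0, x) = (κ ∘L ContinuousLinearMap.inr 𝕜 E (FA →L[𝕜] 𝕜)) x := rfl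
    have h3 : x (covectorControl κ).1 =
        ∑ i, κ (0, LinearMap.toContinuousLinearMap (b.coord i)) * x (b i) := by
      simp only [covectorControl, map_sum, map_smul, smul_eq_mul, b]
    rw [h3, h2, hx, map_sum]
    refine Finset.sum_congr rfl fun i _ ↦ ?_
    rw [map_smul, ← hx, smul_eq_mul, mul_comm]
    rfl
  refine ContinuousLinearMap.ext fun z ↦ ?_
  have h4 : z = (z.1, 0) + (0, z.2) := by simp
  conv_lhs => rw [h4, map_add, h1]
  rfl

end Control

set_option maxHeartbeats 1000000 in
/-- The linear Poisson structure of `B^*`, on covectors pulled back from the chart of `A^*`: the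
Hamiltonian vector fields on `B^*` are mapped to vectors of the form `hamField R C`. By bilinearity,
this reduces to the defining brackets of `ev_a` and of functions on the base. -/
theorem IsQuotientAlgebroid.bivector_eq [FiniteDimensional 𝕜 FA] [IsManifold 𝓘(𝕜, E) ∞ M]
    [IsManifold 𝓘(𝕜, E) n M] [ContMDiffVectorBundle n FA A 𝓘(𝕜, E)]
    (hq : IsQuotientAlgebroid FA n ρ ι q h) (hn : ∞ ≤ n)
    {Λ : PoissonStructure (𝓘(𝕜, EL).prod 𝓘(𝕜, FB →L[𝕜] 𝕜)) n (DualBundle 𝕜 FB B)}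
    (hΛ : LieAlgebroid.IsLinearPoisson h Λ) {m₀ : M} {W : Opens M} (hW : W ≤ coordDomain E FA A m₀)
    {C : E → FA →L[𝕜] FA →L[𝕜] FA}
    (hC : ∀ l, ι l ∈ W → ∀ i j : Fin (Module.finrank 𝕜 FA),
        h.bracket (fun k ↦ q k (frameSection 𝕜 FA A m₀ (Module.finBasis 𝕜 FA i) (ι k)))
          (fun k ↦ q k (frameSection 𝕜 FA A m₀ (Module.finBasis 𝕜 FA j) (ι k))) l =
        q l (frameSection 𝕜 FA A m₀ (C (extChartAt 𝓘(𝕜, E) m₀ (ι l)) (Module.finBasis 𝕜 FA i)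
          (Module.finBasis 𝕜 FA j)) (ι l)))
    {p : DualBundle 𝕜 FB B} (hp : ι p.1 ∈ W)
    {D : TangentSpace (𝓘(𝕜, EL).prod 𝓘(𝕜, FB →L[𝕜] 𝕜)) p →L[𝕜] E × (FA →L[𝕜] 𝕜)}
    (hD : HasMFDerivAt (𝓘(𝕜, EL).prod 𝓘(𝕜, FB →L[𝕜] 𝕜)) 𝓘(𝕜, E × (FA →L[𝕜] 𝕜))
      (pullCoord (E := E) (FA := FA) (FB := FB) ι q m₀) p D)
    (θ κ : E × (FA →L[𝕜] 𝕜) →L[𝕜] 𝕜) :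
    Λ.bivector p (θ ∘L D) (κ ∘L D) =
      θ (hamField (anchorCoord FA ρ m₀) C (pullCoord (E := E) (FA := FA) (FB := FB) ι q m₀ p)
        (covectorControl κ)) := by
  set b := Module.finBasis 𝕜 FA with hb
  let φ := extChartAt 𝓘(𝕜, E) m₀
  let Φ := pullCoord (E := E) (FA := FA) (FB := FB) ι q m₀
  let x := Φ p
  let R := anchorCoord FA ρ m₀
  let V : Opens L := ⟨ι ⁻¹' W, W.2.preimage hq.contMDiff.continuous⟩
  let fst := ContinuousLinearMap.fst 𝕜 E (FA →L[𝕜] 𝕜)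
  let s : FA → Π l : L, B l := fun v l ↦ q l (frameSection 𝕜 FA A m₀ v (ι l))
  have hs : ∀ v, IsSectionOn 𝓘(𝕜, EL) n FB V (s v) := fun v ↦
    hq.isSectionOn (coordDomain E FA A m₀) V _ (fun l hl ↦ hW hl) (isSectionOn_frameSection m₀ v)
  have hφι : ContMDiffOn 𝓘(𝕜, EL) 𝓘(𝕜, E) n (fun l ↦ φ (ι l)) V :=
    (contMDiffOn_extChartAt (I := 𝓘(𝕜, E)) (x := m₀)).comp hq.contMDiff.contMDiffOn
      fun l hl ↦ (hW hl).1
  have hδ : ∀ δ : E →L[𝕜] 𝕜, ContMDiffOn 𝓘(𝕜, EL) 𝓘(𝕜, 𝕜) n (fun l ↦ δ (φ (ι l))) V := fun δ ↦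
    δ.contMDiff.comp_contMDiffOn hφι
  have hd : ∀ θ : E × (FA →L[𝕜] 𝕜) →L[𝕜] 𝕜,
      mfderiv (𝓘(𝕜, EL).prod 𝓘(𝕜, FB →L[𝕜] 𝕜)) 𝓘(𝕜, 𝕜) (fun p ↦ θ (Φ p)) p =
        θ ∘L D := fun θ ↦
    (HasMFDerivAt.comp (g := θ) p θ.hasMFDerivAt hD).mfderiv
  have hbr : ∀ θ κ : E × (FA →L[𝕜] 𝕜) →L[𝕜] 𝕜, Λ.bivector p (θ ∘L D) (κ ∘L D) =
      Λ.bracket (fun p ↦ θ (Φ p)) (fun p ↦ κ (Φ p)) p := by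
    intro θ κ
    rw [← hd θ, ← hd κ]
    rfl
  have hEE : ∀ v w, Λ.bivector p (evalAt E FA v ∘L D) (evalAt E FA w ∘L D) = x.2 (C x.1 v w) := by
    let ev : FA →ₗ[𝕜] TangentSpace (𝓘(𝕜, EL).prod 𝓘(𝕜, FB →L[𝕜] 𝕜)) p →L[𝕜] 𝕜 :=
      { toFun := fun v ↦ evalAt E FA v ∘L D
        map_add' := fun v w ↦ ContinuousLinearMap.ext fun u ↦ map_add (D u).2 v w
        map_smul' := fun c v ↦ ContinuousLinearMap.ext fun u ↦ map_smul (D u).2 c v }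
    refine b.bilinear_apply_eq ((Λ.bivector p).compl₁₂ ev ev) (C x.1) x.2 fun i j ↦ ?_
    refine (hbr _ _).trans ((hΛ.ev_ev V (s (b i)) (s (b j)) (hs _) (hs _) p hp).trans ?_)
    exact congrArg p.2 (hC p.1 hp i j)
  have hEF : ∀ v (δ : E →L[𝕜] 𝕜), Λ.bivector p (evalAt E FA v ∘L D) ((δ ∘L fst) ∘L D) =
      δ (R x.1 v) := by
    intro v δ
    refine (hbr _ _).trans ((hΛ.ev_fun V (s v) _ (hs v) (hδ δ) p hp).trans ?_)
    have h1 : HasMFDerivAt 𝓘(𝕜, EL) 𝓘(𝕜, E) ι p.1 (mfderiv 𝓘(𝕜, EL) 𝓘(𝕜, E) ι p.1) :=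
      ((hq.contMDiff p.1).mdifferentiableAt (by rintro rfl; simp at hn)).hasMFDerivAt
    have h2 : HasMFDerivAt 𝓘(𝕜, E) 𝓘(𝕜, E) φ (ι p.1) (chartDeriv m₀ (ι p.1)) :=
      (mdifferentiableAt_extChartAt (hW hp).1).hasMFDerivAt
    have h3 := HasMFDerivAt.comp (g := δ) p.1 δ.hasMFDerivAt (h2.comp p.1 h1)
    have h4 : dirDeriv 𝓘(𝕜, EL) (fun l ↦ δ (φ (ι l))) p.1 (σ p.1 (s v p.1)) =
        δ (chartDeriv m₀ (ι p.1) (mfderiv 𝓘(𝕜, EL) 𝓘(𝕜, E) ι p.1 (σ p.1 (s v p.1)))) :=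
      DFunLike.congr_fun h3.mfderiv _
    refine h4.trans ?_
    rw [hq.anchor]
    exact congrArg δ (anchorCoord_extChartAt (hW hp) v).symm
  have hFF : ∀ δ δ' : E →L[𝕜] 𝕜, Λ.bivector p ((δ ∘L fst) ∘L D) ((δ' ∘L fst) ∘L D) = 0 := by
    intro δ δ'
    exact (hbr _ _).trans (hΛ.fun_fun V _ _ (hδ δ) (hδ δ') p hp)
  have hFE : ∀ v (δ : E →L[𝕜] 𝕜), Λ.bivector p ((δ ∘L fst) ∘L D) (evalAt E FA v ∘L D) =
      -δ (R x.1 v) := by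
    intro v δ
    have halt : (Λ.bivector p).IsAlt := fun θ ↦ Λ.alternating p θ
    rw [← hEF, halt.neg]
  conv_lhs => rw [eq_covectorControl θ, eq_covectorControl κ]
  conv_rhs => rw [eq_covectorControl θ]
  simp only [ContinuousLinearMap.add_comp, map_add, LinearMap.add_apply]
  erw [hFF, hFE, hEF, hEE]
  simp [hamField, evalAt, x, R]
  abel

/-! ### Invariance under Hamiltonian flows -/

/-- The differential of a function on `B^*` factors through the differential of the map `B^* → A^*`,
with a factor that depends continuously on the point. -/
theorem IsQuotientAlgebroid.exists_factor_mfderiv [FiniteDimensional 𝕜 E]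
    [FiniteDimensional 𝕜 FA] [FiniteDimensional 𝕜 EL] [FiniteDimensional 𝕜 FB]
    [IsManifold 𝓘(𝕜, EL) ∞ L] [IsManifold 𝓘(𝕜, EL) n L] [ContMDiffVectorBundle n FA A 𝓘(𝕜, E)]
    [ContMDiffVectorBundle n FB B 𝓘(𝕜, EL)]
    (hq : IsQuotientAlgebroid FA n ρ ι q h) (hn : ∞ ≤ n) (p₀ : DualBundle 𝕜 FB B)
    {H : DualBundle 𝕜 FB B → 𝕜}
    (hH : ContMDiffAt (𝓘(𝕜, EL).prod 𝓘(𝕜, FB →L[𝕜] 𝕜)) 𝓘(𝕜, 𝕜) n H p₀) :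
    ∃ κ : DualBundle 𝕜 FB B → E × (FA →L[𝕜] 𝕜) →L[𝕜] 𝕜, ∀ᶠ p in 𝓝 p₀, ContinuousAt κ p ∧
      ∃ D : TangentSpace (𝓘(𝕜, EL).prod 𝓘(𝕜, FB →L[𝕜] 𝕜)) p →L[𝕜] E × (FA →L[𝕜] 𝕜),
        HasMFDerivAt (𝓘(𝕜, EL).prod 𝓘(𝕜, FB →L[𝕜] 𝕜)) 𝓘(𝕜, E × (FA →L[𝕜] 𝕜))
          (pullCoord (E := E) (FA := FA) (FB := FB) ι q (ι p₀.1)) p D ∧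
        mfderiv (𝓘(𝕜, EL).prod 𝓘(𝕜, FB →L[𝕜] 𝕜)) 𝓘(𝕜, 𝕜) H p = κ p ∘L D := by
  have : IsManifold (𝓘(𝕜, EL).prod 𝓘(𝕜, FB →L[𝕜] 𝕜)) n (DualBundle 𝕜 FB B) := inferInstance
  have hn1 : (1 : WithTop ℕ∞) ≤ n := le_trans (by simp) hn
  have : IsManifold (𝓘(𝕜, EL).prod 𝓘(𝕜, FB →L[𝕜] 𝕜)) 1 (DualBundle 𝕜 FB B) :=
    IsManifold.of_le hn1
  obtain ⟨f, hf, hf', hfp⟩ := hq.exists_immersion (E := E) (FA := FA) hn p₀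
  set J := 𝓘(𝕜, EL).prod 𝓘(𝕜, FB →L[𝕜] 𝕜) with hJ
  let ζ : DualBundle 𝕜 FB B → EL × (FB →L[𝕜] 𝕜) := dualCoord p₀.1
  have hζ : ⇑(extChartAt J p₀) = ζ := funext fun p ↦ extChartAt_dual_apply p₀ p
  let Ĥ : EL × (FB →L[𝕜] 𝕜) → 𝕜 := H ∘ (extChartAt J p₀).symm
  have hĤ : ContDiffAt 𝕜 1 Ĥ (ζ p₀) := by
    have := (contMDiffAt_iff.1 (hH.of_le hn1)).2
    rw [hζ] at this
    have hr : range J = univ := by simp [hJ]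
    rw [hr, contDiffWithinAt_univ] at this
    exact this
  obtain ⟨κ, hκ⟩ := exists_factor_fderiv hf hĤ hf'
  have hsrc : (chartAt (ModelProd EL (FB →L[𝕜] 𝕜)) p₀).source ∈ 𝓝 p₀ :=
    chart_source_mem_nhds _ p₀
  have hζ₀ : ContinuousAt ζ p₀ := by rw [← hζ]; exact continuousAt_extChartAt p₀
  refine ⟨fun p ↦ κ (ζ p), ?_⟩
  have hev : ∀ᶠ z in 𝓝 (ζ p₀), DifferentiableAt 𝕜 f z ∧ DifferentiableAt 𝕜 Ĥ z := by
    filter_upwards [hf.eventually (by simp), hĤ.eventually (by simp)] with z h1 h2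
    exact ⟨h1.differentiableAt (by simp), h2.differentiableAt (by simp)⟩
  filter_upwards [hsrc, hζ₀.eventually hκ, hζ₀.eventually hev] with p hp hκp hdp
  have hζp : HasMFDerivAt J 𝓘(𝕜, EL × (FB →L[𝕜] 𝕜)) ζ p
      (mfderiv J 𝓘(𝕜, EL × (FB →L[𝕜] 𝕜)) (extChartAt J p₀) p) := by
    rw [← hζ]
    exact (mdifferentiableAt_extChartAt hp).hasMFDerivAt
  have hnear := (chartAt (ModelProd EL (FB →L[𝕜] 𝕜)) p₀).open_source.mem_nhds hp
  have hpull : pullCoord (E := E) (FA := FA) (FB := FB) ι q (ι p₀.1) =ᶠ[𝓝 p] f ∘ ζ := by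
    filter_upwards [hnear] with p' hp'
    rw [chartAt_dual_source] at hp'
    exact hfp p' hp'
  have hHζ : H =ᶠ[𝓝 p] Ĥ ∘ ζ := by
    filter_upwards [hnear] with p' hp'
    simp only [Ĥ, Function.comp_apply, ← hζ]
    rw [(extChartAt J p₀).left_inv (by rwa [extChartAt_source])]
  refine ⟨?_, fderiv 𝕜 f (ζ p) ∘L mfderiv J 𝓘(𝕜, EL × (FB →L[𝕜] 𝕜)) (extChartAt J p₀) p,
    ?_, ?_⟩
  · exact ContinuousAt.comp (f := ζ) hκp.1 hζp.continuousAt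
  · exact (HasMFDerivAt.comp (g := f) p hdp.1.hasFDerivAt.hasMFDerivAt hζp).congr_of_eventuallyEq
      hpull
  · refine ((HasMFDerivAt.comp (g := Ĥ) p hdp.2.hasFDerivAt.hasMFDerivAt
      hζp).congr_of_eventuallyEq hHζ).mfderiv.trans ?_
    rw [hκp.2]
    rfl

/-- Integral curves of Hamiltonian fields cannot enter or leave the restriction of the cone. -/
theorem IsQuotientAlgebroid.eventually_mem_restrictToLeaf_iff [FiniteDimensional 𝕜 E]
    [FiniteDimensional 𝕜 FA] [FiniteDimensional 𝕜 EL] [FiniteDimensional 𝕜 FB]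
    [IsManifold 𝓘(𝕜, E) ∞ M] [IsManifold 𝓘(𝕜, E) n M]
    [IsManifold 𝓘(𝕜, EL) ∞ L] [IsManifold 𝓘(𝕜, EL) n L] [ContMDiffVectorBundle n FA A 𝓘(𝕜, E)]
    [ContMDiffVectorBundle n FB B 𝓘(𝕜, EL)] {F : SingularFoliation 𝓘(𝕜, E) n M}
    (hρ : IsAnchoredBundle FA F ρ) (hq : IsQuotientAlgebroid FA n ρ ι q h) (hn : ∞ ≤ n)
    {Λ : PoissonStructure (𝓘(𝕜, EL).prod 𝓘(𝕜, FB →L[𝕜] 𝕜)) n (DualBundle 𝕜 FB B)}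
    (hΛ : LieAlgebroid.IsLinearPoisson h Λ) {U : Opens (DualBundle 𝕜 FB B)}
    {X : Π p : DualBundle 𝕜 FB B, TangentSpace (𝓘(𝕜, EL).prod 𝓘(𝕜, FB →L[𝕜] 𝕜)) p}
    (hX : X ∈ Λ.hamiltonianFields U) {γ : 𝕜 → DualBundle 𝕜 FB B} {t₀ : 𝕜}
    (hγ : ∀ᶠ t in 𝓝 t₀, γ t ∈ U ∧
      HasMFDerivAt 𝓘(𝕜, 𝕜) (𝓘(𝕜, EL).prod 𝓘(𝕜, FB →L[𝕜] 𝕜)) γ t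
        ((1 : 𝕜 →L[𝕜] 𝕜).smulRight (X (γ t)))) :
    ∀ᶠ t in 𝓝 t₀, (γ t₀ ∈ restrictToLeaf (helfferNourrigatCone FA F ρ) ι q ↔
      γ t ∈ restrictToLeaf (helfferNourrigatCone FA F ρ) ι q) := by
  obtain ⟨H, hH, hXH⟩ := hX
  set p₀ := γ t₀ with hp₀
  set m₀ := ι p₀.1 with hm₀
  obtain ⟨W, C, hmW, hW, hC, hRC, hbr⟩ := hq.exists_structure hn hρ.isBundleMorphism m₀
  let R := anchorCoord (E := E) FA ρ m₀
  let Ψ : 𝕜 → E × (FA →L[𝕜] 𝕜) := fun t ↦ pullCoord ι q m₀ (γ t)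
  have hγ₀ : ContinuousAt γ t₀ := hγ.self_of_nhds.2.continuousAt
  have hHp : ContMDiffAt (𝓘(𝕜, EL).prod 𝓘(𝕜, FB →L[𝕜] 𝕜)) 𝓘(𝕜, 𝕜) n H p₀ :=
    hH.contMDiffAt (U.2.mem_nhds hγ.self_of_nhds.1)
  obtain ⟨κ, hκ⟩ := hq.exists_factor_mfderiv (E := E) (FA := FA) hn p₀ hHp
  have hιγ : ContinuousAt (fun t ↦ ι (γ t).1) t₀ :=
    hq.contMDiff.continuous.continuousAt.comp
      ((FiberBundle.continuous_proj (FB →L[𝕜] 𝕜) (DualFiber 𝕜 B)).continuousAt.comp hγ₀)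
  have hW₀ : ∀ᶠ t in 𝓝 t₀, ι (γ t).1 ∈ W := hιγ (W.2.mem_nhds hmW)
  have hmem : ∀ t, ι (γ t).1 ∈ W → (Ψ t ∈ closure (regularCone R) ↔
      γ t ∈ restrictToLeaf (helfferNourrigatCone FA F ρ) ι q) := fun t ht ↦
    mem_closure_regularCone_iff (α := ⟨ι (γ t).1, (γ t).2 ∘L q (γ t).1⟩) hρ (hW ht)
  have hRC' : ∀ᶠ y in 𝓝 (Ψ t₀).1, ∀ v w, R y (C y v w) =
      fderiv 𝕜 R y (R y v) w - fderiv 𝕜 R y (R y w) v := by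
    have h1 : (extChartAt 𝓘(𝕜, E) m₀).target ∩ (extChartAt 𝓘(𝕜, E) m₀).symm ⁻¹' W ∈
        𝓝 (extChartAt 𝓘(𝕜, E) m₀ m₀) := by
      refine ((continuousOn_extChartAt_symm m₀).isOpen_inter_preimage
        (isOpen_extChartAt_target m₀) W.2).mem_nhds ⟨mem_extChartAt_target m₀, ?_⟩
      rw [mem_preimage, extChartAt_to_inv]
      exact hmW
    filter_upwards [h1] with y hy v w
    have := hRC _ hy.2 v w
    rwa [(extChartAt 𝓘(𝕜, E) m₀).right_inv hy.1] at this
  have hΨ := eventually_mem_closure_regularCone_iff (R := R) (C := C) (Ψ := Ψ)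
    (p := fun t ↦ covectorControl (κ (γ t))) (t₀ := t₀)
    ((contDiffAt_anchorCoord hn hρ.isBundleMorphism (mem_coordDomain m₀)).of_le (by simp)) hC hRC'
    (by
      filter_upwards [hγ, hγ₀.eventually hκ, hW₀] with t ⟨htU, htγ⟩ ⟨hκt, D, hD, hdH⟩ htW
      refine ⟨?_, ?_⟩
      · exact continuous_covectorControl.continuousAt.comp
          (ContinuousAt.comp (f := γ) hκt htγ.continuousAt)
      · have h1 : HasFDerivAt Ψ (D ∘L (1 : 𝕜 →L[𝕜] 𝕜).smulRight (X (γ t))) t :=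
          (HasMFDerivAt.comp t hD htγ).hasFDerivAt
        have h2 : D (X (γ t)) = hamField R C (Ψ t) (covectorControl (κ (γ t))) := by
          -- It suffices to test the two vectors against all covectors.
          refine SeparatingDual.eq_iff_forall_dual_eq (R := 𝕜).2 fun θ ↦ ?_
          rw [← hq.bivector_eq hn hΛ hW hbr htW hD θ (κ (γ t)), ← hdH]
          exact hXH _ htU (θ ∘L D)
        have h3 := h1.hasDerivAt
        rw [← h2]
        convert h3 using 1
        change _ = D ((1 : 𝕜) • X (γ t))
        rw [one_smul])
  filter_upwards [hΨ, hW₀] with t ht htW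
  rw [← hmem t htW, ← ht, hmem t₀ hmW]

/-- A set that is invariant under the steps of Hamiltonian flows is the union of the leaves
through its points. -/
theorem PoissonStructure.isUnionOfSymplecticLeaves_of_flowStep {H P : Type*} [TopologicalSpace H]
    {I : ModelWithCorners 𝕜 E H} [TopologicalSpace P] [ChartedSpace H P]
    {Λ : PoissonStructure I n P} {S : Set P}
    (hS : ∀ x y, FlowStep I Λ.hamiltonianFields x y → x ∈ S → y ∈ S) :
    Λ.IsUnionOfSymplecticLeaves S := by
  refine ⟨S, Subset.antisymm (fun p hp ↦ mem_iUnion₂.2 ⟨p, hp, Relation.ReflTransGen.refl⟩)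
    (iUnion₂_subset fun p hp y hy ↦ ?_)⟩
  induction hy with
  | refl => exact hp
  | tail _ hstep ih => exact hS _ _ hstep ih

/-- The times at which an integral curve is in the restriction of the cone form an open and closed
subset of the connected set of all times. -/
theorem IsQuotientAlgebroid.isUnionOfSymplecticLeaves [FiniteDimensional 𝕜 E]
    [FiniteDimensional 𝕜 FA] [FiniteDimensional 𝕜 EL] [FiniteDimensional 𝕜 FB]
    [IsManifold 𝓘(𝕜, E) ∞ M] [IsManifold 𝓘(𝕜, E) n M]
    [IsManifold 𝓘(𝕜, EL) ∞ L] [IsManifold 𝓘(𝕜, EL) n L] [ContMDiffVectorBundle n FA A 𝓘(𝕜, E)]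
    [ContMDiffVectorBundle n FB B 𝓘(𝕜, EL)] {F : SingularFoliation 𝓘(𝕜, E) n M}
    (hρ : IsAnchoredBundle FA F ρ) (hq : IsQuotientAlgebroid FA n ρ ι q h) (hn : ∞ ≤ n)
    {Λ : PoissonStructure (𝓘(𝕜, EL).prod 𝓘(𝕜, FB →L[𝕜] 𝕜)) n (DualBundle 𝕜 FB B)}
    (hΛ : LieAlgebroid.IsLinearPoisson h Λ) :
    Λ.IsUnionOfSymplecticLeaves (restrictToLeaf (helfferNourrigatCone FA F ρ) ι q) := by
  refine PoissonStructure.isUnionOfSymplecticLeaves_of_flowStep ?_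
  rintro _ _ ⟨U, X, s, γ, hX, hs, hs', hγ, t₀, ht₀, t₁, ht₁, rfl, rfl⟩ h₀
  refine (hs'.induction₂ (fun t t' ↦
    γ t ∈ restrictToLeaf (helfferNourrigatCone FA F ρ) ι q ↔
      γ t' ∈ restrictToLeaf (helfferNourrigatCone FA F ρ) ι q) (fun t ht ↦ ?_)
    (fun _ _ _ _ _ _ h h' ↦ h.trans h') (fun _ _ _ _ h ↦ h.symm) ht₀ ht₁).1 h₀
  refine Filter.Eventually.filter_mono nhdsWithin_le_nhds ?_
  exact hq.eventually_mem_restrictToLeaf_iff hρ hn hΛ hX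
    (by filter_upwards [hs.mem_nhds ht] with t ht using hγ t ht)

/-! ### The annihilator of the strong kernel -/

theorem continuousAt_evSection {U : Opens M} {a : Π x : M, A x}
    (ha : IsSectionOn 𝓘(𝕜, E) n FA U a) {α : DualBundle 𝕜 FA A} (hα : α.1 ∈ U) :
    ContinuousAt (evSection FA a) α := by
  have hproj : Continuous (fun β : DualBundle 𝕜 FA A ↦ β.1) :=
    FiberBundle.continuous_proj (FA →L[𝕜] 𝕜) (DualFiber 𝕜 A)
  have h1 : ContinuousAt (fun β : DualBundle 𝕜 FA A ↦ TotalSpace.mk' FA β.1 (a β.1)) α :=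
    ContinuousAt.comp (f := fun β : DualBundle 𝕜 FA A ↦ β.1)
      (ha.continuousOn.continuousAt (U.2.mem_nhds hα)) hproj.continuousAt
  have h2 := ContinuousAt.clm_bundle_apply (F₁ := FA) (F₂ := 𝕜) (E₁ := A) (E₂ := Bundle.Trivial M 𝕜)
    (b := fun β : DualBundle 𝕜 FA A ↦ β.1) (ϕ := fun β ↦ β.2) (v := fun β ↦ a β.1) (𝕜 := 𝕜)
    (x := α) continuousAt_id h1
  exact ((FiberBundle.continuousAt_totalSpace 𝕜 _).1 h2).2

/-- Elements of the cone vanish on the strong kernel: if `ρ(a) = 0`, then the continuous function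
`ev_a` vanishes on the images of the transposes of the anchor, so on their closure. -/
theorem eq_zero_of_mem_strongKernel {F : SingularFoliation 𝓘(𝕜, E) n M} {α : DualBundle 𝕜 FA A}
    (hα : α ∈ helfferNourrigatCone FA F ρ) {u : A α.1}
    (hu : u ∈ strongKernel 𝓘(𝕜, E) n FA ρ α.1) : α.2 u = 0 := by
  obtain ⟨U, hU, a, ha, hρa, rfl⟩ := hu
  by_contra hne
  have h1 : ∀ᶠ β in 𝓝 α, evSection FA a β ≠ 0 ∧ β.1 ∈ U :=
    ((continuousAt_evSection ha hU).eventually_ne hne).and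
      ((U.2.preimage (FiberBundle.continuous_proj (FA →L[𝕜] 𝕜) (DualFiber 𝕜 A))).mem_nhds hU)
  obtain ⟨β, ⟨-, ξ, hξ⟩, hβ, hβU⟩ := ((mem_closure_iff_frequently.1 hα).and_eventually h1).exists
  refine hβ ((hξ _).trans ?_)
  rw [hρa _ hβU, map_zero]

theorem continuous_of_finiteDimensional_fiber [FiniteDimensional 𝕜 FA] {x : M}
    (β : A x →ₗ[𝕜] 𝕜) : Continuous β := by
  let e := (trivializationAt FA A x).continuousLinearEquivAt 𝕜 x
    (FiberBundle.mem_baseSet_trivializationAt' x)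
  have h1 : Continuous (β ∘ₗ e.symm.toLinearEquiv.toLinearMap : FA →ₗ[𝕜] 𝕜) :=
    LinearMap.continuous_of_finiteDimensional _
  have h2 : ⇑β = (β ∘ₗ e.symm.toLinearEquiv.toLinearMap : FA →ₗ[𝕜] 𝕜) ∘ e := by
    ext u
    simp
  rw [h2]
  exact h1.comp e.continuous

/-- Over a leaf, the elements of the cone descend to the holonomy Lie algebroid. -/
theorem IsHolonomyLieAlgebroid.exists_factor [FiniteDimensional 𝕜 FB]
    {F : SingularFoliation 𝓘(𝕜, E) n M} (hq : IsHolonomyLieAlgebroid FA ρ ι q h) {l : L}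
    {α : DualFiber 𝕜 A (ι l)}
    (hα : (⟨ι l, α⟩ : DualBundle 𝕜 FA A) ∈ helfferNourrigatCone FA F ρ) :
    ∃ β : DualFiber 𝕜 B l, ∀ u, α u = β (q l u) := by
  obtain ⟨s, hs⟩ := (q l).toLinearMap.exists_rightInverse_of_surjective
    (LinearMap.range_eq_top.2 (hq.surjective l))
  let β : B l →ₗ[𝕜] 𝕜 := α.toLinearMap ∘ₗ s
  refine ⟨⟨β, continuous_of_finiteDimensional_fiber (FA := FB) β⟩, fun u ↦ ?_⟩
  have h1 : q l (u - s (q l u)) = 0 := by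
    rw [map_sub, sub_eq_zero]
    exact (LinearMap.congr_fun hs (q l u)).symm
  have h2 : α (u - s (q l u)) = 0 := eq_zero_of_mem_strongKernel hα ((hq.kernel l _).1 h1)
  rw [map_sub, sub_eq_zero] at h2
  exact h2

end Quotient

end

theorem mainTheorem1 {𝕜 : Type*} [RCLike 𝕜] {n : WithTop ℕ∞} (hn : ∞ ≤ n)
    {E : Type*} [NormedAddCommGroup E] [NormedSpace 𝕜 E] [FiniteDimensional 𝕜 E]
    {M : Type*} [TopologicalSpace M] [T2Space M] [SecondCountableTopology M]
    [ChartedSpace E M] [IsManifold 𝓘(𝕜, E) ∞ M] [IsManifold 𝓘(𝕜, E) n M]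
    {FA : Type*} [NormedAddCommGroup FA] [NormedSpace 𝕜 FA] [FiniteDimensional 𝕜 FA]
    {A : M → Type*} [TopologicalSpace (TotalSpace FA A)]
    [∀ x, AddCommGroup (A x)] [∀ x, Module 𝕜 (A x)] [∀ x, TopologicalSpace (A x)]
    [∀ x, IsTopologicalAddGroup (A x)] [∀ x, ContinuousSMul 𝕜 (A x)]
    [FiberBundle FA A] [VectorBundle 𝕜 FA A] [ContMDiffVectorBundle n FA A 𝓘(𝕜, E)]
    (F : SingularFoliation 𝓘(𝕜, E) n M)
    (ρ : Π x : M, A x →L[𝕜] TangentSpace 𝓘(𝕜, E) x) (hρ : IsAnchoredBundle FA F ρ) :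
    (∀ (g : LieAlgebroid 𝓘(𝕜, E) n FA ρ)
      (Λ : PoissonStructure (𝓘(𝕜, E).prod 𝓘(𝕜, FA →L[𝕜] 𝕜)) n (DualBundle 𝕜 FA A)),
      g.IsLinearPoisson Λ →
        Λ.IsUnionOfSymplecticLeaves (helfferNourrigatCone FA F ρ)) ∧
    (∀ {EL : Type*} [NormedAddCommGroup EL] [NormedSpace 𝕜 EL] [FiniteDimensional 𝕜 EL]
      {L : Type*} [TopologicalSpace L] [ChartedSpace EL L]
      [IsManifold 𝓘(𝕜, EL) ∞ L] [IsManifold 𝓘(𝕜, EL) n L]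
      {FB : Type*} [NormedAddCommGroup FB] [NormedSpace 𝕜 FB] [FiniteDimensional 𝕜 FB]
      {B : L → Type*} [TopologicalSpace (TotalSpace FB B)]
      [∀ l, AddCommGroup (B l)] [∀ l, Module 𝕜 (B l)] [∀ l, TopologicalSpace (B l)]
      [∀ l, IsTopologicalAddGroup (B l)] [∀ l, ContinuousSMul 𝕜 (B l)]
      [FiberBundle FB B] [VectorBundle 𝕜 FB B] [ContMDiffVectorBundle n FB B 𝓘(𝕜, EL)]
      (ι : L → M) (q : Π l : L, A (ι l) →L[𝕜] B l)
      (σ : Π l : L, B l →L[𝕜] TangentSpace 𝓘(𝕜, EL) l) (h : LieAlgebroid 𝓘(𝕜, EL) n FB σ)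
      (Λ : PoissonStructure (𝓘(𝕜, EL).prod 𝓘(𝕜, FB →L[𝕜] 𝕜)) n (DualBundle 𝕜 FB B)),
      F.IsLeaf 𝓘(𝕜, EL) ι → IsHolonomyLieAlgebroid FA ρ ι q h → h.IsLinearPoisson Λ →
        (∀ (l : L) (α : DualFiber 𝕜 A (ι l)), (TotalSpace.mk (ι l) α : DualBundle 𝕜 FA A) ∈ helfferNourrigatCone FA F ρ →
            ∃ β : DualFiber 𝕜 B l, ∀ u, α u = β (q l u)) ∧
        Λ.IsUnionOfSymplecticLeaves (restrictToLeaf (helfferNourrigatCone FA F ρ) ι q)) := by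
  refine ⟨fun g Λ hΛ ↦ ?_, ?_⟩
  · exact g.isQuotientAlgebroid_id.isUnionOfSymplecticLeaves hρ hn hΛ
  · intro EL _ _ _ L _ _ _ _ FB _ _ _ B _ _ _ _ _ _ _ _ _ ι q σ h Λ hι hq hΛ
    exact ⟨fun l α hα ↦ hq.exists_factor hα,
      (hq.isQuotientAlgebroid hρ hι).isUnionOfSymplecticLeaves hρ hn hΛ⟩
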